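/- Let $(X_1,Y_1),(X_2,Y_2),\dots$ be independent, identically distributed pairs of real random variables with joint density $g(s,t)\ge 0$. Put $f(s)=\int_{\mathbb R} g(s,t)\,dt$ (the density of $X$), $a(s)=\int_{\mathbb R} t\,g(s,t)\,dt$, $r(s)=a(s)/f(s)=\mathbb E[Y\mid X=s]$, and $\mathbb E[Y^2\mid X=s]=f(s)^{-1}\int_{\mathbb R}t^2g(s,t)\,dt$. Let $(\beta_n)_{n\ge1}$ and $(h_n)_{n\ge 1}$ be sequences of positive reals, let $\gamma_n=n^{-1}$, and fix $x\in\mathbb R$. Set $a_0(x)=f_0(x)=0$ and, for $n\ge1$, $$a_n(x)=(1-\beta_n)a_{n-1}(x)+\beta_nh_n^{-1}Y_nK\left(\frac{x-X_n}{h_n}\right),\qquad f_n(x)=(1-\gamma_n)f_{n-1}(x)+\gamma_nh_n^{-1}K\left(\frac{x-X_n}{h_n}\right),$$ and $r_n(x)=a_n(x)/f_n(x)$ if $f_n(x)\ne0$, $r_n(x)=0$ otherwise. For $\gamma\in\mathbb R$, a positive sequence $(v_n)_{n\ge1}$ is said to belong to $\mathcal{GS}(\gamma)$ if $\lim_{n\to\infty}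 n\left[1-v_{n-1}/v_n\right]=\gamma$. Assume the following. (A1) $K:\mathbb R\to\mathbb R$ is continuous and bounded, $K$ and $z^2K(z)$ are integrable, $\int K(z)\,dz=1$ and $\int zK(z)\,dz=0$. (A2) (i) $(\beta_n)\in\mathcal{GS}(-\beta)$ with $\beta\in(1/2,1]$; (ii) $(h_n)\in\mathcal{GS}(-a)$ with a number $a\in(0,1)$; (iii) $\lim_{n\to\infty}n\beta_n$ exists in $\left(\min\{2a,(\beta-a)/2\},\infty\right]$. (A3) (i) For every $t$, $s\mapsto g(s,t)$ is twice continuously differentiable. (ii) For $q\in\{0,1,2\}$, $s\mapsto\int t^qg(s,t)\,dt$ is a bounded function, continuous at $s=x$; for real $q\in[2,3]$, $s\mapsto\int|t|^qg(s,t)\,dt$ is a bounded function. (iii) For $q\in\{0,1\}$, $\int|t|^q\left|\frac{\partial g}{\partial s}(x,t)\right|dt<\infty$, and $s\mapsto\int t^q\frac{\partial^2g}{\partial s^2}(s,t)\,dt$ is a bounded function, continuous at $s=x$. Assume moreover that $f(x)>0$ and that $f$ and $a(\cdot)$ are twice differentiable at $x$, with second derivatives $f^{(2)}(x)$ and $a^{(2)}(x)$.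 Write $\xi=\lim_{n\to\infty}(n\beta_n)^{-1}$, $\mu_2(K)=\int z^2K(z)\,dz$, $R(K)=\int K^2(z)\,dz$, and $$B^{(1)}_{a,\xi}(x)=\frac1{2f(x)}\left(\frac{a^{(2)}(x)}{1-2a\xi}-\frac{r(x)f^{(2)}(x)}{1-2a}\right)\mu_2(K),$$ $$V^{(1)}_{a,\xi,\beta}(x)=\left\{\frac{\mathbb E[Y^2\mid X=x]}{(2-(\beta-a)\xi)f(x)}-\left(\frac{2\xi}{1+a\xi}-\frac{\xi}{1+a}\right)\frac{r^2(x)}{f(x)}\right\}R(K).$$ 1. If $\beta_n^{-1}h_n\to\infty$ (which is automatic when $a<\beta$) and $\beta_n^{-1}h_n^5\to c$ for some $c\ge0$, then $V^{(1)}_{a,\xi,\beta}(x)\ge 0$ and $$\sqrt{\beta_n^{-1}h_n}\,\bigl(r_n(x)-r(x)\bigr)\ \longrightarrow\ \mathcal N\left(\sqrt c\,B^{(1)}_{a,\xi}(x),\,V^{(1)}_{a,\xi,\beta}(x)\right)\quad\text{in distribution}$$ (for $c=0$ the mean is $0$, also when a denominator in $B^{(1)}_{a,\xi}(x)$ vanishes).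 2. If $\beta_n^{-1}h_n^5\to\infty$, then $h_n^{-2}\bigl(r_n(x)-r(x)\bigr)\to B^{(1)}_{a,\xi}(x)$ in probability. -/

import Mathlib

open MeasureTheory ProbabilityTheory Filter Topology

noncomputable section

namespace SemiRec

/-- The Galambos--Seneta class `GS(γ)`: sequences `(v_n)_{n ≥ 1}` of positive reals such that
`n (1 - v_{n-1} / v_n) → γ`. The value `v 0` plays no role. -/
def GS (γ : ℝ) (v : ℕ → ℝ) : Prop :=
  (∀ n : ℕ, 1 ≤ n → 0 < v n) ∧
    Tendsto (fun n : ℕ => ((n : ℝ) + 1) * (1 - v n / v (n + 1))) atTop (𝓝 γ)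

/-- `R(K) = ∫ K²`. -/
def R (K : ℝ → ℝ) : ℝ := ∫ z, K z ^ 2

/-- `μ_j(K) = ∫ z^j K(z) dz`. -/
def kernelMoment (j : ℕ) (K : ℝ → ℝ) : ℝ := ∫ z, z ^ j * K z

/-- `s ↦ ∫ t^q g(s,t) dt`. -/
def mom (g : ℝ → ℝ → ℝ) (q : ℕ) (s : ℝ) : ℝ := ∫ t, t ^ q * g s t

/-- The density `f` of `X`, where `g` is the joint density of `(X, Y)`. -/
def dens (g : ℝ → ℝ → ℝ) (s : ℝ) : ℝ := mom g 0 s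

/-- The function `a(s) = E[Y | X = s] f(s) = ∫ t g(s,t) dt`. -/
def afun (g : ℝ → ℝ → ℝ) (s : ℝ) : ℝ := mom g 1 s

/-- The regression function `r(s) = E[Y | X = s] = a(s) / f(s)`. -/
def regr (g : ℝ → ℝ → ℝ) (s : ℝ) : ℝ := afun g s / dens g s

/-- `E[Y² | X = s]`. -/
def condSecondMoment (g : ℝ → ℝ → ℝ) (s : ℝ) : ℝ := mom g 2 s / dens g s

/-- Assumption (A1) on the kernel. -/
structure A1 (K : ℝ → ℝ) : Prop where
  cont : Continuous K
  bounded : ∃ C : ℝ, ∀ z, |K z| ≤ C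
  integrable : Integrable K
  integral_eq_one : ∫ z, K z = 1
  integrable_sq_mul : Integrable (fun z => z ^ 2 * K z)
  integral_mul_eq_zero : ∫ z, z * K z = 0

/-- Assumption (A2) on the stepsize `(β_n)` and the bandwidth `(h_n)`. In (iii) the sequence
`n β_n` has a limit in `(min {2a, (β - a)/2}, ∞]`. -/
structure A2 (β a : ℝ) (βs h : ℕ → ℝ) : Prop where
  step : GS (-β) βs
  lt_β : 1 / 2 < β
  β_le : β ≤ 1
  bandwidth : GS (-a) h
  a_pos : 0 < a
  a_lt : a < 1
  limit : (∃ L : ℝ, min (2 * a) ((β - a) / 2) < L ∧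
      Tendsto (fun n : ℕ => (n : ℝ) * βs n) atTop (𝓝 L)) ∨
    Tendsto (fun n : ℕ => (n : ℝ) * βs n) atTop atTop

/-- Assumption (A3) on the joint density `g`, at the point `x`. -/
structure A3 (g : ℝ → ℝ → ℝ) (x : ℝ) : Prop where
  smooth : ∀ t, ContDiff ℝ 2 (fun s => g s t)
  integrable_mom : ∀ q : ℕ, q ≤ 2 → ∀ s, Integrable (fun t => t ^ q * g s t)
  bounded_mom : ∀ q : ℕ, q ≤ 2 → ∃ C : ℝ, ∀ s, |mom g q s| ≤ C
  cont_mom : ∀ q : ℕ, q ≤ 2 → ContinuousAt (mom g q) x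
  integrable_absMom : ∀ q : ℝ, 2 ≤ q → q ≤ 3 → ∀ s, Integrable (fun t => |t| ^ q * g s t)
  bounded_absMom : ∀ q : ℝ, 2 ≤ q → q ≤ 3 → ∃ C : ℝ, ∀ s, ∫ t, |t| ^ q * g s t ≤ C
  integrable_deriv : ∀ q : ℕ, q ≤ 1 →
    Integrable (fun t => |t| ^ q * |deriv (fun s => g s t) x|)
  integrable_deriv2 : ∀ q : ℕ, q ≤ 1 → ∀ s,
    Integrable (fun t => t ^ q * iteratedDeriv 2 (fun s' => g s' t) s)
  bounded_deriv2 : ∀ q : ℕ, q ≤ 1 → ∃ C : ℝ, ∀ s,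
    |∫ t, t ^ q * iteratedDeriv 2 (fun s' => g s' t) s| ≤ C
  cont_deriv2 : ∀ q : ℕ, q ≤ 1 →
    ContinuousAt (fun s => ∫ t, t ^ q * iteratedDeriv 2 (fun s' => g s' t) s) x

/-- `F` has a second derivative at the point `x`. -/
def TwiceDifferentiableAt (F : ℝ → ℝ) (x : ℝ) : Prop :=
  (∀ᶠ s in 𝓝 x, DifferentiableAt ℝ F s) ∧ DifferentiableAt ℝ (deriv F) x

/-- `(X_1, Y_1), (X_2, Y_2), …` are independent random pairs, each with joint density `g`
(the index `0` is not used). -/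
structure IsSample {Ω : Type*} [MeasurableSpace Ω] (P : Measure Ω) (X Y : ℕ → Ω → ℝ)
    (g : ℝ → ℝ → ℝ) : Prop where
  meas_X : ∀ n, 1 ≤ n → Measurable (X n)
  meas_Y : ∀ n, 1 ≤ n → Measurable (Y n)
  indep : iIndepFun (fun (n : ℕ) (ω : Ω) => (X (n + 1) ω, Y (n + 1) ω)) P
  meas_g : Measurable (fun p : ℝ × ℝ => g p.1 p.2)
  nonneg_g : ∀ s t, 0 ≤ g s t
  law : ∀ n, 1 ≤ n → P.map (fun ω => (X n ω, Y n ω)) =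
    (volume : Measure (ℝ × ℝ)).withDensity (fun p => ENNReal.ofReal (g p.1 p.2))

section Estimators

variable {Ω : Type*} (K : ℝ → ℝ) (h : ℕ → ℝ) (x : ℝ)

/-- The recursive estimator `a_n(x)` with stepsize `(β_n)` and `a_0(x) = 0`. -/
def aEst (βs : ℕ → ℝ) (X Y : ℕ → Ω → ℝ) : ℕ → Ω → ℝ
  | 0, _ => 0
  | n + 1, ω => (1 - βs (n + 1)) * aEst βs X Y n ω +
      βs (n + 1) * ((h (n + 1))⁻¹ * Y (n + 1) ω * K ((h (n + 1))⁻¹ * (x - X (n + 1) ω)))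

/-- The recursive estimator `f_n(x)` with stepsize `(γ_n)` and `f_0(x) = 0`. -/
def fEst (γs : ℕ → ℝ) (X : ℕ → Ω → ℝ) : ℕ → Ω → ℝ
  | 0, _ => 0
  | n + 1, ω => (1 - γs (n + 1)) * fEst γs X n ω +
      γs (n + 1) * ((h (n + 1))⁻¹ * K ((h (n + 1))⁻¹ * (x - X (n + 1) ω)))

open Classical in
/-- The semi-recursive estimator `r_n(x)`. -/
def rEst (βs γs : ℕ → ℝ) (X Y : ℕ → Ω → ℝ) (n : ℕ) (ω : Ω) : ℝ :=
  if fEst K h x γs X n ω ≠ 0 then aEst K h x βs X Y n ω / fEst K h x γs X n ω else 0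

end Estimators

/-- The bias constant `B_{a,ξ}(x)`. -/
def biasConst (K : ℝ → ℝ) (g : ℝ → ℝ → ℝ) (a ξ x : ℝ) : ℝ :=
  1 / (2 * dens g x) *
    (iteratedDeriv 2 (afun g) x / (1 - 2 * a * ξ) -
      regr g x * iteratedDeriv 2 (dens g) x / (1 - 2 * a)) * kernelMoment 2 K

/-- The variance constant `V_{a,ξ,β}(x)`. -/
def varConst (K : ℝ → ℝ) (g : ℝ → ℝ → ℝ) (a ξ β x : ℝ) : ℝ :=
  (condSecondMoment g x / ((2 - (β - a) * ξ) * dens g x) -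
    (2 * ξ / (1 + a * ξ) - ξ / (1 + a)) * (regr g x ^ 2 / dens g x)) * R K

end SemiRec

end

/-! Wherever f_n(x) is nonzero, r_n - r = (a_n - r f_n) / f_n. The denominator converges to f(x) in
mean square, so it may be replaced by f(x) as soon as the normalised numerator stays bounded in mean
square (`tendstoInMeasure_mul_ratio_sub`). Unfolding the two recursions writes a_n - r f_n as a sum
of independent terms `residual` with deterministic triangular weights. What remains is to control
its mean, its variance and its third absolute moments.

Each of these follows a scalar recursion z(n+1) = (1 - s m) z(n) + s q. Against a regularly varying
scale u of exponent κ, and with (n s_n)⁻¹ → ξ, the quotient z/u tends to w / (m + κ ξ), where w is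
the limit of q/u (`StepSize.tendsto_div_of_rec`). Every constant of the theorem has this form. The
bias has m = 1 and, at scale h², κ = -2a: hence 1 - 2aξ for the numerator and 1 - 2a for the
denominator, whose stepsize 1/n has ξ = 1. At scale β_n / h_n one has κ = a - β; the two variances
have m = 2, and the covariance has m = 1 + ξ because the ratio of the stepsizes tends to ξ. The
identity (1 - β) ξ = 0 brings these to the stated shape.

Kernel smoothing supplies the inputs q: a second-order Taylor expansion for the means, Bochner's
lemma for the second moments, uniform bounds for the third (`IsSample.kernelMoments`). If β_n⁻¹ h_n⁵
has a finite limit, then β ≤ 5a and Lyapunov's theorem gives normality; if it diverges, then β ≥ 5a,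
the variance is negligible against h_n⁴ and only the bias survives. These inequalities decide which
term of the minimum in the assumption on lim n β_n is active, and that term is what keeps the
quantities m + κ ξ positive. -/

noncomputable section

namespace SemiRec

/-! ### Affine recursions and the Galambos--Seneta class -/

/-- A recursion `t (n+1) = (1 - b n p n) t n + b n w n` with small steps of infinite total length
converges to `w / p`. -/
theorem tendsto_of_affine_rec {t b p w : ℕ → ℝ} {p₀ w₀ : ℝ}
    (hrec : ∀ᶠ n in atTop, t (n + 1) = (1 - b n * p n) * t n + b n * w n)
    (hb : ∀ n, 0 ≤ b n) (hb0 : Tendsto b atTop (𝓝 0))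
    (hsum : Tendsto (fun n => ∑ k ∈ Finset.range n, b k) atTop atTop)
    (hp : Tendsto p atTop (𝓝 p₀)) (hp₀ : 0 < p₀) (hw : Tendsto w atTop (𝓝 w₀)) :
    Tendsto t atTop (𝓝 (w₀ / p₀)) := by
  set l := w₀ / p₀ with hl
  have hδ : Tendsto (fun n => |w n - p n * l|) atTop (𝓝 0) := by
    have : Tendsto (fun n => |w n - p n * l|) atTop (𝓝 |w₀ - p₀ * l|) :=
      (hw.sub (hp.mul_const l)).abs
    rwa [hl, mul_div_cancel₀ _ hp₀.ne', sub_self, abs_zero] at this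
  rw [Metric.tendsto_atTop']
  intro ε hε
  have h1 : ∀ᶠ n in atTop, p₀ / 2 < p n := hp.eventually (lt_mem_nhds (by linarith))
  have h2 : ∀ᶠ n in atTop, b n * p n < 1 := by
    have : Tendsto (fun n => b n * p n) atTop (𝓝 (0 * p₀)) := hb0.mul hp
    rw [zero_mul] at this
    exact this.eventually (gt_mem_nhds one_pos)
  have h3 : ∀ᶠ n in atTop, |w n - p n * l| < p₀ / 2 * (ε / 2) :=
    hδ.eventually (gt_mem_nhds (by positivity))
  obtain ⟨N, hN⟩ := eventually_atTop.1 (hrec.and (h1.and (h2.and h3)))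
  -- Only the excess of the error over ε/2 is tracked. Eventually the forcing is below (p₀/2)(ε/2)
  -- per unit step, which the contraction absorbs, so the excess shrinks by exp(-p₀ b/2) at each
  -- step; these factors multiply to the exponential of a divergent negative sum.
  set d : ℕ → ℝ := fun n => max (|t n - l| - ε / 2) 0 with hd
  have hd0 : ∀ n, 0 ≤ d n := fun n => le_max_right _ _
  have hstep : ∀ n, N ≤ n → d (n + 1) ≤ Real.exp (-(p₀ / 2 * b n)) * d n := by
    intro n hn
    obtain ⟨e, i1, i2, i3⟩ := hN n hn
    have e1 : t (n + 1) - l = (1 - b n * p n) * (t n - l) + b n * (w n - p n * l) := by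
      rw [e]; ring
    have e2 : |t (n + 1) - l| ≤ (1 - b n * p n) * |t n - l| + b n * |w n - p n * l| := by
      rw [e1]
      refine (abs_add_le _ _).trans ?_
      rw [abs_mul, abs_mul, abs_of_nonneg (hb n), abs_of_nonneg (by linarith : 0 ≤ 1 - b n * p n)]
    have e3 : b n * |w n - p n * l| ≤ b n * (p₀ / 2 * (ε / 2)) :=
      mul_le_mul_of_nonneg_left i3.le (hb n)
    have e4 : (1 - b n * p n) * |t n - l| ≤ (1 - b n * p n) * (d n + ε / 2) :=
      mul_le_mul_of_nonneg_left (by have := le_max_left (|t n - l| - ε / 2) 0; simp only [hd]; linarith)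
        (by linarith)
    have e5 : b n * (p₀ / 2) ≤ b n * p n := mul_le_mul_of_nonneg_left i1.le (hb n)
    have e6 : (1 - b n * p n) * (d n + ε / 2) ≤ (1 - b n * (p₀ / 2)) * (d n + ε / 2) :=
      mul_le_mul_of_nonneg_right (by linarith) (by have := hd0 n; linarith)
    have e7 : 1 - b n * (p₀ / 2) ≤ Real.exp (-(p₀ / 2 * b n)) := by
      have := Real.add_one_le_exp (-(p₀ / 2 * b n)); linarith
    have e8 := mul_le_mul_of_nonneg_right e7 (hd0 n)
    refine max_le ?_ (mul_nonneg (Real.exp_pos _).le (hd0 n))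
    nlinarith
  have hbound : ∀ n, N ≤ n → d n ≤ (d N * Real.exp (p₀ / 2 * ∑ k ∈ Finset.range N, b k)) *
      Real.exp (-(p₀ / 2 * ∑ k ∈ Finset.range n, b k)) := by
    intro n hn
    induction n, hn using Nat.le_induction with
    | base => rw [mul_assoc, ← Real.exp_add]; simp
    | succ n hn ih =>
      refine (hstep n hn).trans ?_
      refine (mul_le_mul_of_nonneg_left ih (Real.exp_pos _).le).trans (le_of_eq ?_)
      rw [Finset.sum_range_succ, mul_add, neg_add, Real.exp_add]; ring
  have hlim : Tendsto (fun n => (d N * Real.exp (p₀ / 2 * ∑ k ∈ Finset.range N, b k)) *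
      Real.exp (-(p₀ / 2 * ∑ k ∈ Finset.range n, b k))) atTop (𝓝 0) := by
    have := (Real.tendsto_exp_neg_atTop_nhds_zero.comp
      (hsum.const_mul_atTop (by positivity : 0 < p₀ / 2))).const_mul
      (d N * Real.exp (p₀ / 2 * ∑ k ∈ Finset.range N, b k))
    simpa using this
  obtain ⟨M, hM⟩ := eventually_atTop.1 (hlim.eventually (gt_mem_nhds (half_pos hε)))
  refine ⟨max N M, fun n hn => ?_⟩
  have a1 := hbound n ((le_max_left _ _).trans hn.le)
  have a2 := hM n ((le_max_right _ _).trans hn.le)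
  have a3 := le_max_left (|t n - l| - ε / 2) 0
  rw [Real.dist_eq]
  simp only [hd] at a1
  linarith

/-- The factorisation F y = y · `dslope F 0 y`, with a slope continuous at 0, needs no case
distinction at y = 0. -/
theorem tendsto_mul_of_hasDerivAt {F : ℝ → ℝ} {d γ : ℝ} (hF : HasDerivAt F d 0) (hF0 : F 0 = 0)
    {c y : ℕ → ℝ} (hy : Tendsto y atTop (𝓝 0)) (hcy : Tendsto (fun n => c n * y n) atTop (𝓝 γ)) :
    Tendsto (fun n => c n * F (y n)) atTop (𝓝 (γ * d)) := by
  have h1 : ContinuousAt (dslope F 0) 0 := continuousAt_dslope_same.2 hF.differentiableAt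
  have h2 : Tendsto (fun n => dslope F 0 (y n)) atTop (𝓝 d) := by
    have := h1.tendsto.comp hy
    rwa [dslope_same, hF.deriv] at this
  refine (hcy.mul h2).congr fun n => ?_
  have := sub_smul_dslope F 0 (y n)
  rw [hF0, sub_zero, sub_zero, smul_eq_mul] at this
  rw [← this]; ring

theorem tendsto_zero_of_succ_mul {y : ℕ → ℝ} {γ : ℝ}
    (h : Tendsto (fun n : ℕ => ((n : ℝ) + 1) * y n) atTop (𝓝 γ)) : Tendsto y atTop (𝓝 0) := by
  have := h.mul tendsto_one_div_add_atTop_nhds_zero_nat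
  rw [mul_zero] at this
  refine this.congr fun n => ?_
  have : (n : ℝ) + 1 ≠ 0 := by positivity
  field_simp

/-- Logarithmic form of the Galambos--Seneta condition: `v` is positive from rank one on and
`n (log v_n - log v_{n-1}) → γ`. -/
structure LogGS (γ : ℝ) (v : ℕ → ℝ) : Prop where
  pos : ∀ n : ℕ, 1 ≤ n → 0 < v n
  tendsto : Tendsto (fun n : ℕ => ((n : ℝ) + 1) * (Real.log (v (n + 1)) - Real.log (v n)))
    atTop (𝓝 γ)

/-- With y = 1 - v_{n-1}/v_n the increment of log v is -log(1 - y), whose derivative at 0 is 1. In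
logarithmic form exponents simply add under products and scale under powers and roots. -/
theorem GS.logGS {γ : ℝ} {v : ℕ → ℝ} (h : GS γ v) : LogGS γ v := by
  refine ⟨h.1, ?_⟩
  have hF : HasDerivAt (fun y : ℝ => -Real.log (1 - y)) 1 0 := by
    have h1 : HasDerivAt (fun y : ℝ => 1 - y) (-1) 0 := by
      simpa using (hasDerivAt_id (0 : ℝ)).const_sub 1
    simpa using (h1.log (by norm_num)).fun_neg
  have := tendsto_mul_of_hasDerivAt hF (by simp) (tendsto_zero_of_succ_mul h.2) h.2
  rw [mul_one] at this
  refine this.congr' ?_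
  filter_upwards [eventually_ge_atTop 1] with n hn
  rw [sub_sub_cancel, Real.log_div (h.1 n hn).ne' (h.1 (n + 1) (by omega)).ne']
  ring

namespace LogGS

variable {γ γ' : ℝ} {v v' : ℕ → ℝ}

theorem tendsto_ratio (h : LogGS γ v) :
    Tendsto (fun n : ℕ => ((n : ℝ) + 1) * (1 - v n / v (n + 1))) atTop (𝓝 γ) := by
  have hF : HasDerivAt (fun y : ℝ => 1 - Real.exp (-y)) 1 0 := by
    have h1 : HasDerivAt (fun y : ℝ => -y) (-1) 0 := hasDerivAt_neg 0
    simpa using h1.exp.const_sub 1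
  have := tendsto_mul_of_hasDerivAt hF (by simp) (tendsto_zero_of_succ_mul h.tendsto) h.tendsto
  rw [mul_one] at this
  refine this.congr' ?_
  filter_upwards [eventually_ge_atTop 1] with n hn
  rw [neg_sub, Real.exp_sub, Real.exp_log (h.pos n hn), Real.exp_log (h.pos (n + 1) (by omega))]

theorem mul (h : LogGS γ v) (h' : LogGS γ' v') : LogGS (γ + γ') (fun n => v n * v' n) := by
  refine ⟨fun n hn => mul_pos (h.pos n hn) (h'.pos n hn), (h.tendsto.add h'.tendsto).congr' ?_⟩
  filter_upwards [eventually_ge_atTop 1] with n hn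
  rw [Real.log_mul (h.pos n hn).ne' (h'.pos n hn).ne',
    Real.log_mul (h.pos (n + 1) (by omega)).ne' (h'.pos (n + 1) (by omega)).ne']
  ring

theorem inv (h : LogGS γ v) : LogGS (-γ) (fun n => (v n)⁻¹) := by
  refine ⟨fun n hn => inv_pos.2 (h.pos n hn), h.tendsto.neg.congr fun n => ?_⟩
  rw [Real.log_inv, Real.log_inv]; ring

theorem pow (h : LogGS γ v) (m : ℕ) : LogGS (m * γ) (fun n => v n ^ m) := by
  refine ⟨fun n hn => pow_pos (h.pos n hn) m, (h.tendsto.const_mul (m : ℝ)).congr fun n => ?_⟩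
  rw [Real.log_pow, Real.log_pow]; ring

theorem sqrt (h : LogGS γ v) : LogGS (γ / 2) (fun n => √(v n)) := by
  refine ⟨fun n hn => Real.sqrt_pos.2 (h.pos n hn), (h.tendsto.div_const 2).congr' ?_⟩
  filter_upwards [eventually_ge_atTop 1] with n hn
  rw [Real.log_sqrt (h.pos n hn).le, Real.log_sqrt (h.pos (n + 1) (by omega)).le]
  ring

theorem one : LogGS 0 (fun _ => 1) := ⟨fun _ _ => one_pos, by simp⟩

end LogGS

theorem logGS_inv_natCast : LogGS (-1) (fun n : ℕ => (n : ℝ)⁻¹) := by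
  have : GS (-1) (fun n : ℕ => (n : ℝ)⁻¹) := by
    refine ⟨fun n hn => by positivity, ?_⟩
    have h1 : Tendsto (fun n : ℕ => -(1 + ((n : ℝ))⁻¹)) atTop (𝓝 (-(1 + 0))) :=
      (tendsto_inv_atTop_nhds_zero_nat.const_add 1).neg
    rw [add_zero] at h1
    refine h1.congr' ?_
    filter_upwards [eventually_ge_atTop 1] with n hn
    have : (n : ℝ) ≠ 0 := by positivity
    have : (n : ℝ) + 1 ≠ 0 := by positivity
    push_cast
    field_simp
    ring
  exact this.logGS

/-- A stepsize sequence: positive, tending to `0`, with `(n s_n)⁻¹ → ξ`. -/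
structure StepSize (ξ : ℝ) (s : ℕ → ℝ) : Prop where
  pos : ∀ n : ℕ, 1 ≤ n → 0 < s n
  tendsto_zero : Tendsto s atTop (𝓝 0)
  tendsto_inv : Tendsto (fun n : ℕ => ((n : ℝ) * s n)⁻¹) atTop (𝓝 ξ)

theorem stepSize_inv_natCast : StepSize 1 (fun n : ℕ => (n : ℝ)⁻¹) where
  pos n hn := by positivity
  tendsto_zero := tendsto_inv_atTop_nhds_zero_nat
  tendsto_inv := by
    refine tendsto_const_nhds.congr' ?_
    filter_upwards [eventually_ge_atTop 1] with n hn
    have : (n : ℝ) ≠ 0 := by positivity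
    field_simp

/-- A finite ξ makes 1/n at most a constant times s_n eventually, so the harmonic series forces
divergence. -/
theorem StepSize.tendsto_sum {ξ : ℝ} {s : ℕ → ℝ} (hs : StepSize ξ s) :
    Tendsto (fun n => ∑ k ∈ Finset.range n, s (k + 1)) atTop atTop := by
  rw [← not_summable_iff_tendsto_nat_atTop_of_nonneg fun n => (hs.pos (n + 1) (by omega)).le]
  intro hsum
  have hC : 0 < |ξ| + 1 := by positivity
  have h1 : ∀ᶠ n : ℕ in atTop, ((n : ℝ) * s n)⁻¹ < |ξ| + 1 :=
    hs.tendsto_inv.eventually (gt_mem_nhds (by have := le_abs_self ξ; linarith))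
  have h2 : Summable (fun n : ℕ => (n : ℝ)⁻¹) := by
    have h3 : Summable (fun n : ℕ => (|ξ| + 1) * s n) :=
      ((summable_nat_add_iff 1).1 hsum).mul_left _
    refine Summable.of_norm_bounded_eventually_nat h3 ?_
    filter_upwards [h1, eventually_ge_atTop 1] with n hn hn1
    have hn0 : (0 : ℝ) < n := by positivity
    have hsn := hs.pos n hn1
    rw [Real.norm_of_nonneg (by positivity)]
    rw [mul_inv, ← div_eq_mul_inv, div_lt_iff₀ hsn] at hn
    exact hn.le
  exact Real.not_summable_natCast_inv h2

/-- Converts a rate per 1/n into a rate per step s_n; this is how ξ enters the limiting constants.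
-/
theorem StepSize.tendsto_mul_div {ξ γ : ℝ} {s y : ℕ → ℝ} (hs : StepSize ξ s)
    (hy : Tendsto (fun n : ℕ => ((n : ℝ) + 1) * y n) atTop (𝓝 γ)) :
    Tendsto (fun n : ℕ => y n / s (n + 1)) atTop (𝓝 (γ * ξ)) := by
  have h1 := (tendsto_add_atTop_iff_nat 1).2 hs.tendsto_inv
  refine (hy.mul h1).congr fun n => ?_
  have := (hs.pos (n + 1) (by omega)).ne'
  have : (n : ℝ) + 1 ≠ 0 := by positivity
  push_cast
  field_simp

/-- Asymptotics of the recursion `z (n+1) = (1 - s m) z n + s q n` relative to a sequence `u` of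
Galambos--Seneta type. -/
theorem StepSize.tendsto_div_of_rec {ξ κ m₀ w₀ : ℝ} {s u z m q : ℕ → ℝ} (hs : StepSize ξ s)
    (hu : LogGS κ u)
    (hrec : ∀ᶠ n in atTop, z (n + 1) = (1 - s (n + 1) * m n) * z n + s (n + 1) * q n)
    (hm : Tendsto m atTop (𝓝 m₀)) (hq : Tendsto (fun n => q n / u (n + 1)) atTop (𝓝 w₀))
    (hpos : 0 < m₀ + κ * ξ) :
    Tendsto (fun n => z n / u n) atTop (𝓝 (w₀ / (m₀ + κ * ξ))) := by
  set y : ℕ → ℝ := fun n => 1 - u n / u (n + 1) with hy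
  have hy1 : Tendsto (fun n => y n / s (n + 1)) atTop (𝓝 (κ * ξ)) :=
    hs.tendsto_mul_div hu.tendsto_ratio
  have hy0 : Tendsto y atTop (𝓝 0) := tendsto_zero_of_succ_mul hu.tendsto_ratio
  -- Passing to z/u multiplies the old value by (1 - s m)(1 - y) = 1 - s (m + y/s - m y), again an
  -- affine recursion, with rate tending to m₀ + κξ.
  have hp : Tendsto (fun n => m n + y n / s (n + 1) - m n * y n) atTop (𝓝 (m₀ + κ * ξ)) := by
    simpa using (hm.add hy1).sub (hm.mul hy0)
  refine tendsto_of_affine_rec (b := fun n => s (n + 1)) ?_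
    (fun n => (hs.pos (n + 1) (by omega)).le)
    ((tendsto_add_atTop_iff_nat 1).2 hs.tendsto_zero) hs.tendsto_sum hp hpos hq
  filter_upwards [hrec, eventually_ge_atTop 1] with n hn hn1
  have h1 := (hu.pos n hn1).ne'
  have h2 := (hu.pos (n + 1) (by omega)).ne'
  have h3 := (hs.pos (n + 1) (by omega)).ne'
  rw [hn]
  simp only [hy]
  field_simp
  ring

namespace LogGS

variable {γ : ℝ} {v : ℕ → ℝ}

theorem tendsto_zero_of_neg (h : LogGS γ v) (hγ : γ < 0) : Tendsto v atTop (𝓝 0) := by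
  have hs := stepSize_inv_natCast
  have h1 := h.inv
  -- The constant 1 solves the recursion with m = q = 0. Against v⁻¹, of positive exponent -γ, its
  -- quotient is v, which therefore tends to 0 / (-γ).
  have := hs.tendsto_div_of_rec (z := fun _ => 1) (m := fun _ => 0) (q := fun _ => 0) h1
    (Eventually.of_forall fun n => by simp) tendsto_const_nhds (w₀ := 0) (by simp)
    (by linarith)
  simpa using this

/-- A positive exponent would send v⁻¹ to 0, hence v · v⁻¹ = 1 to c · 0. -/
theorem nonpos_of_tendsto (h : LogGS γ v) {c : ℝ} (hc : Tendsto v atTop (𝓝 c)) : γ ≤ 0 := by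
  by_contra! hγ
  have h1 := hc.mul (h.inv.tendsto_zero_of_neg (by linarith))
  rw [mul_zero] at h1
  have h2 : Tendsto (fun n => v n * (v n)⁻¹) atTop (𝓝 1) := by
    refine tendsto_const_nhds.congr' ?_
    filter_upwards [eventually_ge_atTop 1] with n hn
    rw [mul_inv_cancel₀ (h.pos n hn).ne']
  exact zero_ne_one (tendsto_nhds_unique h1 h2)

theorem nonneg_of_tendsto_atTop (h : LogGS γ v) (hc : Tendsto v atTop atTop) : 0 ≤ γ := by
  have := h.inv.nonpos_of_tendsto (tendsto_inv_atTop_zero.comp hc)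
  linarith

theorem eq_zero_of_tendsto (h : LogGS γ v) {c : ℝ} (hc : Tendsto v atTop (𝓝 c)) (hc0 : c ≠ 0) :
    γ = 0 := by
  have h1 := h.nonpos_of_tendsto hc
  have h2 := h.inv.nonpos_of_tendsto (hc.inv₀ hc0)
  linarith

end LogGS

/-! ### Lyapunov's central limit theorem for triangular arrays -/

/-- Factors are exchanged one at a time; those left in place have norm at most 1. -/
theorem norm_prod_sub_prod_le_sum {ι : Type*} (s : Finset ι) {a b : ι → ℂ}
    (ha : ∀ i ∈ s, ‖a i‖ ≤ 1) (hb : ∀ i ∈ s, ‖b i‖ ≤ 1) :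
    ‖∏ i ∈ s, a i - ∏ i ∈ s, b i‖ ≤ ∑ i ∈ s, ‖a i - b i‖ := by
  classical
  induction s using Finset.induction_on with
  | empty => simp
  | insert i s hi ih =>
    rw [Finset.prod_insert hi, Finset.prod_insert hi, Finset.sum_insert hi]
    have h1 : ‖∏ j ∈ s, a j‖ ≤ 1 := by
      rw [norm_prod]
      exact Finset.prod_le_one (fun _ _ => norm_nonneg _)
        fun j hj => ha j (Finset.mem_insert_of_mem hj)
    have h2 := ih (fun j hj => ha j (Finset.mem_insert_of_mem hj))
      (fun j hj => hb j (Finset.mem_insert_of_mem hj))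
    have h3 := hb i (Finset.mem_insert_self i s)
    calc ‖a i * ∏ j ∈ s, a j - b i * ∏ j ∈ s, b j‖
        = ‖(a i - b i) * ∏ j ∈ s, a j + b i * (∏ j ∈ s, a j - ∏ j ∈ s, b j)‖ := by congr 1; ring
      _ ≤ ‖a i - b i‖ * ‖∏ j ∈ s, a j‖ + ‖b i‖ * ‖∏ j ∈ s, a j - ∏ j ∈ s, b j‖ := by
        refine (norm_add_le _ _).trans ?_
        rw [norm_mul, norm_mul]
      _ ≤ ‖a i - b i‖ * 1 + 1 * ∑ j ∈ s, ‖a j - b j‖ := by gcongr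
      _ = _ := by ring

/-- For |y| ≤ 1 this is the exponential remainder; for |y| ≥ 1 each term is dominated by |y|³, with
total at most 7/2. The bound on the whole line avoids any truncation of the variables. -/
theorem norm_exp_I_sub_taylor_le (y : ℝ) :
    ‖Complex.exp (y * Complex.I) - (1 + y * Complex.I - ((y ^ 2 / 2 : ℝ) : ℂ))‖ ≤ 4 * |y| ^ 3 := by
  have e : ((1 : ℂ) + y * Complex.I - ((y ^ 2 / 2 : ℝ) : ℂ)) =
      ∑ m ∈ Finset.range 3, ((y : ℂ) * Complex.I) ^ m / (m.factorial : ℂ) := by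
    simp only [Finset.sum_range_succ, Finset.range_zero, Finset.sum_empty, Nat.factorial]
    push_cast
    rw [show ((y : ℂ) * Complex.I) ^ 2 = -(y : ℂ) ^ 2 by rw [mul_pow, Complex.I_sq]; ring]
    simp
    ring
  have hn : ‖(y : ℂ) * Complex.I‖ = |y| := by simp
  rcases le_total |y| 1 with h | h
  · rw [e]
    refine (Complex.exp_bound (by rw [hn]; exact h) (by norm_num : 0 < 3)).trans ?_
    rw [hn, mul_comm]
    refine mul_le_mul_of_nonneg_right ?_ (by positivity)
    norm_num [Nat.factorial]
  · have h1 : ‖Complex.exp (y * Complex.I)‖ = 1 := Complex.norm_exp_ofReal_mul_I y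
    have h2 : ‖((1 : ℂ) + y * Complex.I - ((y ^ 2 / 2 : ℝ) : ℂ))‖ ≤ 1 + |y| + y ^ 2 / 2 := by
      refine (norm_sub_le _ _).trans ?_
      refine add_le_add ((norm_add_le _ _).trans ?_) ?_
      · rw [hn, norm_one]
      · rw [Complex.norm_real, Real.norm_of_nonneg (by positivity)]
    refine (norm_sub_le _ _).trans ?_
    rw [h1]
    have h3 : y ^ 2 = |y| ^ 2 := (sq_abs y).symm
    have h4 : |y| ≤ |y| ^ 3 := le_self_pow₀ h (by norm_num)
    have h5 : |y| ^ 2 ≤ |y| ^ 3 := pow_le_pow_right₀ h (by norm_num)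
    have h6 : 1 ≤ |y| ^ 3 := one_le_pow₀ h
    linarith

/-- The Gaussian counterpart, used with y² = t²σ²/2. A cubic error is kept so that it is comparable
with a third moment. -/
theorem abs_exp_neg_sq_sub_le {y : ℝ} (hy : 0 ≤ y) :
    |Real.exp (-y ^ 2) - (1 - y ^ 2)| ≤ y ^ 3 := by
  rcases le_total y 1 with h | h
  · have h1 := Real.abs_exp_sub_one_sub_id_le (x := -y ^ 2)
      (by rw [abs_neg, abs_of_nonneg (by positivity)]; nlinarith)
    have h2 : (-y ^ 2) ^ 2 ≤ y ^ 3 := by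
      have : (-y ^ 2) ^ 2 = y ^ 4 := by ring
      rw [this]
      exact pow_le_pow_of_le_one hy h (by norm_num)
    refine le_trans (le_of_eq ?_) (h1.trans h2)
    congr 1; ring
  · have h1 : 0 ≤ Real.exp (-y ^ 2) - (1 - y ^ 2) := by
      have := Real.add_one_le_exp (-y ^ 2); linarith
    have h2 : Real.exp (-y ^ 2) ≤ 1 := Real.exp_le_one_iff.2 (by nlinarith)
    have h3 : y ^ 2 ≤ y ^ 3 := pow_le_pow_right₀ h (by norm_num)
    rw [abs_of_nonneg h1]
    linarith

section Moments

variable {Ω : Type*} [MeasurableSpace Ω] {P : Measure Ω} [IsProbabilityMeasure P] {Z : Ω → ℝ}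

theorem integrable_pow_of_cube (hZ : AEStronglyMeasurable Z P)
    (h3 : Integrable (fun ω => |Z ω| ^ 3) P) {m : ℕ} (hm : m ≤ 3) :
    Integrable (fun ω => Z ω ^ m) P := by
  refine Integrable.mono' ((integrable_const (1 : ℝ)).add h3) (hZ.pow m) (Eventually.of_forall fun ω => ?_)
  rw [norm_pow, Real.norm_eq_abs, Pi.add_apply]
  rcases le_total |Z ω| 1 with h | h
  · have := pow_le_one₀ (n := m) (abs_nonneg (Z ω)) h
    have : 0 ≤ |Z ω| ^ 3 := by positivity
    linarith
  · have := pow_le_pow_right₀ h hm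
    linarith

/-- Lyapunov's inequality between the second and third absolute moments, up to a constant. -/
theorem sqrt_second_moment_cube_le (hZ : AEStronglyMeasurable Z P)
    (h3 : Integrable (fun ω => |Z ω| ^ 3) P) :
    √(∫ ω, Z ω ^ 2 ∂P) ^ 3 ≤ 3 * ∫ ω, |Z ω| ^ 3 ∂P := by
  set σ := √(∫ ω, Z ω ^ 2 ∂P) with hσ
  have hint : 0 ≤ ∫ ω, Z ω ^ 2 ∂P := integral_nonneg fun _ => sq_nonneg _
  have hσ2 : σ ^ 2 = ∫ ω, Z ω ^ 2 ∂P := Real.sq_sqrt hint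
  have hT : 0 ≤ ∫ ω, |Z ω| ^ 3 ∂P := integral_nonneg fun _ => by positivity
  rcases (Real.sqrt_nonneg (∫ ω, Z ω ^ 2 ∂P)).eq_or_lt with h0 | h0
  · rw [hσ, ← h0]; simpa using hT
  -- Splitting at |Z| = σ/2. After integration σ²/4 is absorbed on the left, leaving σ³ ≤ (8/3)
  -- E|Z|³.
  have hle : ∀ ω, Z ω ^ 2 ≤ σ ^ 2 / 4 + 2 / σ * |Z ω| ^ 3 := by
    intro ω
    rcases le_total |Z ω| (σ / 2) with h | h
    · have h1 : |Z ω| ^ 2 ≤ (σ / 2) ^ 2 := pow_le_pow_left₀ (abs_nonneg _) h 2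
      rw [sq_abs] at h1
      have : 0 ≤ 2 / σ * |Z ω| ^ 3 := by positivity
      nlinarith
    · have h1 : 1 ≤ 2 / σ * |Z ω| := by
        rw [div_mul_eq_mul_div, le_div_iff₀ h0]; linarith
      have h2 : Z ω ^ 2 ≤ (2 / σ * |Z ω|) * |Z ω| ^ 2 := by
        rw [← sq_abs]; exact le_mul_of_one_le_left (by positivity) h1
      have : 0 ≤ σ ^ 2 / 4 := by positivity
      nlinarith
  have hI : ∫ ω, Z ω ^ 2 ∂P ≤ σ ^ 2 / 4 + 2 / σ * ∫ ω, |Z ω| ^ 3 ∂P := by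
    have := integral_mono (integrable_pow_of_cube hZ h3 (by norm_num))
      ((integrable_const (σ ^ 2 / 4)).add (h3.const_mul (2 / σ))) hle
    refine this.trans (le_of_eq ?_)
    simp only [Pi.add_apply]
    rw [integral_add (integrable_const _) (h3.const_mul _), integral_const_mul]
    simp
  rw [← hσ2] at hI
  have h4 : σ * (3 / 4 * σ ^ 2) ≤ σ * (2 / σ * ∫ ω, |Z ω| ^ 3 ∂P) :=
    mul_le_mul_of_nonneg_left (by linarith) h0.le
  have h5 : σ * (2 / σ * ∫ ω, |Z ω| ^ 3 ∂P) = 2 * ∫ ω, |Z ω| ^ 3 ∂P := by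
    have : σ ≠ 0 := h0.ne'
    rw [← mul_assoc, mul_div_cancel₀ _ this]
  rw [h5] at h4
  nlinarith

/-- Comparison of the characteristic function of a centered variable with a Gaussian one. -/
theorem norm_charFun_sub_exp_le (hZ : AEMeasurable Z P)
    (h3 : Integrable (fun ω => |Z ω| ^ 3) P) (h0 : ∫ ω, Z ω ∂P = 0) (t : ℝ) :
    ‖charFun (P.map Z) t - ((Real.exp (-(t ^ 2 * (∫ ω, Z ω ^ 2 ∂P) / 2)) : ℝ) : ℂ)‖ ≤
      7 * |t| ^ 3 * ∫ ω, |Z ω| ^ 3 ∂P := by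
  have hZs := hZ.aestronglyMeasurable
  have hi1 : Integrable Z P := by
    simpa using integrable_pow_of_cube hZs h3 (m := 1) (by norm_num)
  have hi2 : Integrable (fun ω => Z ω ^ 2) P := integrable_pow_of_cube hZs h3 (by norm_num)
  have hT : 0 ≤ ∫ ω, |Z ω| ^ 3 ∂P := integral_nonneg fun _ => by positivity
  set S := ∫ ω, Z ω ^ 2 ∂P with hS
  have hS0 : 0 ≤ S := integral_nonneg fun _ => sq_nonneg _
  have hcf : charFun (P.map Z) t = ∫ ω, Complex.exp (((t * Z ω : ℝ) : ℂ) * Complex.I) ∂P := by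
    rw [charFun_apply_real, integral_map hZ (by fun_prop)]
    simp
  have hiexp : Integrable (fun ω => Complex.exp (((t * Z ω : ℝ) : ℂ) * Complex.I)) P := by
    refine Integrable.mono' (integrable_const (1 : ℝ)) ?_ (Eventually.of_forall fun ω => ?_)
    · have : AEMeasurable (fun ω => Complex.exp (((t * Z ω : ℝ) : ℂ) * Complex.I)) P := by fun_prop
      exact this.aestronglyMeasurable
    · rw [Complex.norm_exp_ofReal_mul_I]
  have hitay1 : Integrable (fun ω => ((t * Z ω : ℝ) : ℂ) * Complex.I) P :=
    (hi1.const_mul t).ofReal.mul_const _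
  have hitay2 : Integrable (fun ω => (((t * Z ω) ^ 2 / 2 : ℝ) : ℂ)) P := by
    have : Integrable (fun ω => (t * Z ω) ^ 2 / 2) P := by
      refine (hi2.const_mul (t ^ 2 / 2)).congr (Eventually.of_forall fun ω => ?_)
      simp only; ring
    exact this.ofReal
  have hitay3 : Integrable (fun ω => (1 : ℂ) + ((t * Z ω : ℝ) : ℂ) * Complex.I) P :=
    (integrable_const _).add hitay1
  have hitay : Integrable (fun ω => (1 : ℂ) + ((t * Z ω : ℝ) : ℂ) * Complex.I -
      (((t * Z ω) ^ 2 / 2 : ℝ) : ℂ)) P := hitay3.sub hitay2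
  have htay : ∫ ω, ((1 : ℂ) + ((t * Z ω : ℝ) : ℂ) * Complex.I - (((t * Z ω) ^ 2 / 2 : ℝ) : ℂ)) ∂P =
      ((1 - t ^ 2 * S / 2 : ℝ) : ℂ) := by
    rw [integral_sub hitay3 hitay2, integral_add (integrable_const _) hitay1,
      integral_mul_const, integral_complex_ofReal, integral_complex_ofReal, integral_const_mul, h0]
    have : ∫ ω, (t * Z ω) ^ 2 / 2 ∂P = t ^ 2 * S / 2 := by
      rw [hS, ← integral_const_mul, ← integral_div]
      congr 1; ext ω; ring
    rw [this]
    simp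
  have h1 : ‖charFun (P.map Z) t - ((1 - t ^ 2 * S / 2 : ℝ) : ℂ)‖ ≤
      4 * |t| ^ 3 * ∫ ω, |Z ω| ^ 3 ∂P := by
    rw [hcf, ← htay, ← integral_sub hiexp hitay,
      ← integral_const_mul]
    refine norm_integral_le_of_norm_le (h3.const_mul _) (Eventually.of_forall fun ω => ?_)
    refine (norm_exp_I_sub_taylor_le (t * Z ω)).trans (le_of_eq ?_)
    rw [abs_mul, mul_pow]; ring
  have h2 : ‖((1 - t ^ 2 * S / 2 : ℝ) : ℂ) - ((Real.exp (-(t ^ 2 * S / 2)) : ℝ) : ℂ)‖ ≤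
      3 * |t| ^ 3 * ∫ ω, |Z ω| ^ 3 ∂P := by
    rw [← Complex.ofReal_sub, Complex.norm_real, Real.norm_eq_abs, abs_sub_comm]
    -- With y = |t|σ/√2 the error y³ is at most |t|³σ³, and the moment inequality supplies the
    -- factor 3. Together with the 4 of the Taylor bound it makes the final 7.
    have hy : 0 ≤ |t| * √S / √2 := by positivity
    have hy2 : (|t| * √S / √2) ^ 2 = t ^ 2 * S / 2 := by
      rw [div_pow, mul_pow, sq_abs, Real.sq_sqrt hS0, Real.sq_sqrt (by norm_num)]
    have hexp := abs_exp_neg_sq_sub_le hy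
    rw [hy2] at hexp
    refine hexp.trans ?_
    have h4 := sqrt_second_moment_cube_le hZs h3
    have h5 : |t| * √S / √2 ≤ |t| * √S := div_le_self (by positivity) (by
      rw [Real.one_le_sqrt]; norm_num)
    calc (|t| * √S / √2) ^ 3 ≤ (|t| * √S) ^ 3 := pow_le_pow_left₀ hy h5 3
      _ = |t| ^ 3 * √S ^ 3 := by ring
      _ ≤ |t| ^ 3 * (3 * ∫ ω, |Z ω| ^ 3 ∂P) := mul_le_mul_of_nonneg_left h4 (by positivity)
      _ = _ := by ring
  calc _ = ‖(charFun (P.map Z) t - ((1 - t ^ 2 * S / 2 : ℝ) : ℂ)) +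
        (((1 - t ^ 2 * S / 2 : ℝ) : ℂ) - ((Real.exp (-(t ^ 2 * S / 2)) : ℝ) : ℂ))‖ := by
        congr 1; ring
    _ ≤ _ := (norm_add_le _ _).trans (by linarith)

end Moments

/-- **Lyapunov's central limit theorem** for triangular arrays of row-wise independent centered
variables, with convergent deterministic shifts. -/
theorem tendstoInDistribution_of_lyapunov {Ω : Type*} [MeasurableSpace Ω] {P : Measure Ω}
    [IsProbabilityMeasure P] {Z : ℕ → ℕ → Ω → ℝ} {b : ℕ → ℝ} {b₀ V : ℝ}
    (hind : ∀ n, iIndepFun (Z n) P) (hmeas : ∀ n k, AEMeasurable (Z n k) P)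
    (h3 : ∀ n k, Integrable (fun ω => |Z n k ω| ^ 3) P) (h0 : ∀ n k, ∫ ω, Z n k ω ∂P = 0)
    (hV : Tendsto (fun n => ∑ k ∈ Finset.range n, ∫ ω, Z n k ω ^ 2 ∂P) atTop (𝓝 V))
    (hL : Tendsto (fun n => ∑ k ∈ Finset.range n, ∫ ω, |Z n k ω| ^ 3 ∂P) atTop (𝓝 0))
    (hb : Tendsto b atTop (𝓝 b₀)) :
    TendstoInDistribution (fun n ω => b n + ∑ k ∈ Finset.range n, Z n k ω) atTop (id : ℝ → ℝ)
      (fun _ => P) (gaussianReal b₀ V.toNNReal) := by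
  have hV0 : 0 ≤ V := ge_of_tendsto' hV fun n =>
    Finset.sum_nonneg fun k _ => integral_nonneg fun _ => sq_nonneg _
  have hsm : ∀ n, AEMeasurable (fun ω => ∑ k ∈ Finset.range n, Z n k ω) P := fun n =>
    Finset.aemeasurable_fun_sum _ fun k _ => hmeas n k
  refine ⟨fun n => (hsm n).const_add _, aemeasurable_id, ?_⟩
  refine ProbabilityMeasure.tendsto_iff_tendsto_charFun.2 fun t => ?_
  simp only [ProbabilityMeasure.coe_mk, Measure.map_id]
  have hcf : ∀ n, charFun (P.map (fun ω => b n + ∑ k ∈ Finset.range n, Z n k ω)) t =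
      Complex.exp (((t * b n : ℝ) : ℂ) * Complex.I) *
        ∏ k ∈ Finset.range n, charFun (P.map (Z n k)) t := by
    intro n
    have h1 : charFun (P.map (fun ω => ∑ k ∈ Finset.range n, Z n k ω)) t =
        ∏ k ∈ Finset.range n, charFun (P.map (Z n k)) t := by
      rw [((hind n).restrict _).charFun_map_fun_finsetSum_eq_prod (fun _ _ => hmeas n _)]
      simp
    rw [← h1, charFun_apply_real, charFun_apply_real, integral_map ((hsm n).const_add _) (by fun_prop),
      integral_map (hsm n) (by fun_prop), ← integral_const_mul]
    congr 1; ext ω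
    rw [← Complex.exp_add]
    congr 1; push_cast; ring
  have hprod : Tendsto (fun n => ∏ k ∈ Finset.range n, charFun (P.map (Z n k)) t) atTop
      (𝓝 ((Real.exp (-(t ^ 2 * V / 2)) : ℝ) : ℂ)) := by
    have h1 : Tendsto (fun n => ∏ k ∈ Finset.range n,
        ((Real.exp (-(t ^ 2 * (∫ ω, Z n k ω ^ 2 ∂P) / 2)) : ℝ) : ℂ)) atTop
        (𝓝 ((Real.exp (-(t ^ 2 * V / 2)) : ℝ) : ℂ)) := by
      have h2 : Tendsto (fun n => Real.exp (-(t ^ 2 * (∑ k ∈ Finset.range n, ∫ ω, Z n k ω ^ 2 ∂P) / 2)))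
          atTop (𝓝 (Real.exp (-(t ^ 2 * V / 2)))) :=
        (Real.continuous_exp.tendsto _).comp ((hV.const_mul (t ^ 2)).div_const 2).neg
      refine ((Complex.continuous_ofReal.tendsto _).comp h2).congr fun n => ?_
      simp only [Function.comp_apply]
      rw [← Complex.ofReal_prod, ← Real.exp_sum]
      congr 2
      rw [Finset.sum_neg_distrib, Finset.mul_sum, Finset.sum_div]
    -- Exchanging every characteristic function for the Gaussian one of equal variance costs at most
    -- 7|t|³ times the Lyapunov sum.
    have h2 : Tendsto (fun n => ∏ k ∈ Finset.range n, charFun (P.map (Z n k)) t -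
        ∏ k ∈ Finset.range n, ((Real.exp (-(t ^ 2 * (∫ ω, Z n k ω ^ 2 ∂P) / 2)) : ℝ) : ℂ)) atTop
        (𝓝 0) := by
      have h3' := hL.const_mul (7 * |t| ^ 3)
      rw [mul_zero] at h3'
      refine squeeze_zero_norm (fun n => ?_) h3'
      have : ∀ k, IsProbabilityMeasure (P.map (Z n k)) := fun k =>
        Measure.isProbabilityMeasure_map (hmeas n k)
      refine (norm_prod_sub_prod_le_sum _ (fun k _ => norm_charFun_le_one t) fun k _ => ?_).trans ?_
      · rw [Complex.norm_real, Real.norm_of_nonneg (Real.exp_pos _).le, Real.exp_le_one_iff]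
        have : 0 ≤ ∫ ω, Z n k ω ^ 2 ∂P := integral_nonneg fun _ => sq_nonneg _
        have : 0 ≤ t ^ 2 * ∫ ω, Z n k ω ^ 2 ∂P := by positivity
        linarith
      · rw [Finset.mul_sum]
        exact Finset.sum_le_sum fun k _ =>
          norm_charFun_sub_exp_le (hmeas n k) (h3 n k) (h0 n k) t
    simpa using h2.add h1
  have hexp : Tendsto (fun n => Complex.exp (((t * b n : ℝ) : ℂ) * Complex.I)) atTop
      (𝓝 (Complex.exp (((t * b₀ : ℝ) : ℂ) * Complex.I))) := by
    refine (Complex.continuous_exp.tendsto _).comp (Tendsto.mul_const _ ?_)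
    exact (Complex.continuous_ofReal.tendsto _).comp (hb.const_mul t)
  have := hexp.mul hprod
  simp_rw [hcf]
  convert this using 2
  rw [charFun_gaussianReal, Complex.ofReal_exp, ← Complex.exp_add]
  congr 1
  have : ((V.toNNReal : ℝ) : ℂ) = (V : ℂ) := by rw [Real.coe_toNNReal _ hV0]
  rw [this]
  push_cast
  ring

/-! ### Kernel smoothing -/

section Smoothing

/-- Expectation of a function of the form `τ(Y) φ((x - X) / h)`. -/
theorem integral_kernel_mul {Ω : Type*} [MeasurableSpace Ω] {P : Measure Ω} {X Y : Ω → ℝ}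
    {g : ℝ → ℝ → ℝ} (hX : Measurable X) (hY : Measurable Y)
    (hg : Measurable (fun p : ℝ × ℝ => g p.1 p.2)) (hg0 : ∀ s t, 0 ≤ g s t)
    (hlaw : P.map (fun ω => (X ω, Y ω)) =
      (volume : Measure (ℝ × ℝ)).withDensity (fun p => ENNReal.ofReal (g p.1 p.2)))
    {φ τ : ℝ → ℝ} (hφm : Measurable φ) (hφ : Integrable φ) (hτ : Measurable τ)
    (hτi : ∀ s, Integrable (fun t => τ t * g s t)) {C : ℝ}
    (hC : ∀ s, ∫ t, |τ t| * g s t ≤ C) (x : ℝ) {h : ℝ} (hh : 0 < h) :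
    Integrable (fun ω => τ (Y ω) * φ (h⁻¹ * (x - X ω))) P ∧
      ∫ ω, τ (Y ω) * φ (h⁻¹ * (x - X ω)) ∂P =
        h * ∫ z, φ z * ∫ t, τ t * g (x - h * z) t := by
  set F : ℝ × ℝ → ℝ := fun p => τ p.2 * φ (h⁻¹ * (x - p.1)) with hF
  have hFm : Measurable F := by fun_prop
  have hXY : Measurable fun ω => (X ω, Y ω) := hX.prodMk hY
  have hdm : Measurable fun p : ℝ × ℝ => ENNReal.ofReal (g p.1 p.2) := hg.ennreal_ofReal
  have hφs : Integrable fun s => φ (h⁻¹ * (x - s)) :=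
    (hφ.comp_mul_left' (inv_ne_zero hh.ne')).comp_sub_left x
  have e1 : ∀ p : ℝ × ℝ, (ENNReal.ofReal (g p.1 p.2)).toReal • F p =
      φ (h⁻¹ * (x - p.1)) * (τ p.2 * g p.1 p.2) := fun p => by
    rw [ENNReal.toReal_ofReal (hg0 _ _), hF, smul_eq_mul]; ring
  have hint : Integrable (fun p : ℝ × ℝ => φ (h⁻¹ * (x - p.1)) * (τ p.2 * g p.1 p.2))
      ((volume : Measure ℝ).prod volume) := by
    have hm : Measurable fun p : ℝ × ℝ => φ (h⁻¹ * (x - p.1)) * (τ p.2 * g p.1 p.2) := by fun_prop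
    rw [integrable_prod_iff hm.aestronglyMeasurable]
    refine ⟨Eventually.of_forall fun s => (hτi s).const_mul (φ (h⁻¹ * (x - s))), ?_⟩
    refine (hφs.norm.mul_const C).mono' hm.norm.aestronglyMeasurable.integral_prod_right'
      (Eventually.of_forall fun s => ?_)
    rw [Real.norm_of_nonneg (integral_nonneg fun _ => norm_nonneg _)]
    simp_rw [norm_mul]
    rw [integral_const_mul]
    refine mul_le_mul_of_nonneg_left (le_trans (le_of_eq ?_) (hC s)) (norm_nonneg _)
    congr 1; ext t
    rw [Real.norm_eq_abs, Real.norm_of_nonneg (hg0 s t)]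
  have hiF : Integrable F (P.map fun ω => (X ω, Y ω)) := by
    rw [hlaw, integrable_withDensity_iff_integrable_smul' hdm
      (Eventually.of_forall fun _ => ENNReal.ofReal_lt_top)]
    simp_rw [e1]
    exact hint
  refine ⟨hiF.comp_measurable hXY, ?_⟩
  have e2 : ∫ ω, τ (Y ω) * φ (h⁻¹ * (x - X ω)) ∂P = ∫ p, F p ∂(P.map fun ω => (X ω, Y ω)) := by
    rw [integral_map hXY.aemeasurable hFm.aestronglyMeasurable]
  rw [e2, hlaw, integral_withDensity_eq_integral_toReal_smul hdm
    (Eventually.of_forall fun _ => ENNReal.ofReal_lt_top)]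
  simp_rw [e1]
  rw [Measure.volume_eq_prod, integral_prod _ hint]
  simp_rw [integral_const_mul]
  -- Substitutions s = x - u and u = h z; the Jacobian is the factor h of the conclusion.
  have e3 := integral_sub_left_eq_self
    (fun s => φ (h⁻¹ * (x - s)) * ∫ t, τ t * g s t) (volume : Measure ℝ) x
  have e4 := Measure.integral_comp_mul_left
    (fun u => φ (h⁻¹ * (x - (x - u))) * ∫ t, τ t * g (x - u) t) h
  rw [e3, abs_of_pos (inv_pos.2 hh), smul_eq_mul] at e4
  have e5 : ∀ z, φ (h⁻¹ * (x - (x - h * z))) = φ z := fun z => by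
    congr 1; field_simp; ring
  simp_rw [e5] at e4
  rw [e4, mul_inv_cancel_left₀ hh.ne']

/-- Bochner's lemma for kernel smoothing. -/
theorem tendsto_integral_kernel {φ m : ℝ → ℝ} (hφ : Integrable φ) (hm : Measurable m) {C x : ℝ}
    (hC : ∀ s, |m s| ≤ C) (hc : ContinuousAt m x) {h : ℕ → ℝ} (hh : Tendsto h atTop (𝓝 0)) :
    Tendsto (fun n => ∫ z, φ z * m (x - h n * z)) atTop (𝓝 (m x * ∫ z, φ z)) := by
  rw [← integral_const_mul]
  refine tendsto_integral_of_dominated_convergence (fun z => ‖φ z‖ * C)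
    (fun n => hφ.aestronglyMeasurable.mul (hm.comp (by fun_prop)).aestronglyMeasurable)
    (hφ.norm.mul_const C) (fun n => Eventually.of_forall fun z => ?_)
    (Eventually.of_forall fun z => ?_)
  · rw [norm_mul]
    exact mul_le_mul_of_nonneg_left (hC _) (norm_nonneg _)
  · rw [mul_comm (m x)]
    refine Tendsto.const_mul _ (hc.tendsto.comp ?_)
    have := (hh.mul_const z).const_sub x
    simpa using this

/-- Second-order Taylor expansion at a point, with Peano remainder. -/
theorem TwiceDifferentiableAt.isLittleO {F : ℝ → ℝ} {x : ℝ} (hF : TwiceDifferentiableAt F x) :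
    (fun u => F (x + u) - F x - deriv F x * u - iteratedDeriv 2 F x / 2 * u ^ 2)
      =o[𝓝 0] fun u : ℝ => u ^ 2 := by
  have e2 : iteratedDeriv 2 F x = deriv (deriv F) x := by
    rw [iteratedDeriv_succ, iteratedDeriv_one]
  set D := iteratedDeriv 2 F x with hD
  rw [Asymptotics.isLittleO_iff]
  intro ε hε
  have h1 := hF.2.hasDerivAt
  rw [← e2, hasDerivAt_iff_isLittleO_nhds_zero, Asymptotics.isLittleO_iff] at h1
  have hx : Tendsto (fun u : ℝ => x + u) (𝓝 0) (𝓝 x) := by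
    have : Tendsto (fun u : ℝ => x + u) (𝓝 0) (𝓝 (x + 0)) := tendsto_id.const_add x
    simpa using this
  obtain ⟨δ, hδ, hball⟩ := Metric.eventually_nhds_iff_ball.1 ((h1 hε).and (hx.eventually hF.1))
  refine Metric.eventually_nhds_iff_ball.2 ⟨δ, hδ, fun u hu => ?_⟩
  set G : ℝ → ℝ := fun u => F (x + u) - F x - deriv F x * u - D / 2 * u ^ 2 with hG
  -- The second derivative exists only at x, so the mean value inequality is applied to the
  -- remainder G: its derivative at v is the first-order remainder of F', which is o(v).
  have hder : ∀ v ∈ Metric.closedBall (0 : ℝ) |u|,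
      HasDerivAt G (deriv F (x + v) - deriv F x - v • D) v := by
    intro v hv
    have hv' : v ∈ Metric.ball (0 : ℝ) δ := by
      rw [mem_closedBall_zero_iff] at hv
      rw [mem_ball_zero_iff] at hu ⊢
      exact hv.trans_lt hu
    have h2 : HasDerivAt (fun u => F (x + u)) (deriv F (x + v)) v :=
      ((hball v hv').2.hasDerivAt).comp_const_add x v
    have h3 := ((h2.sub_const (F x)).sub ((hasDerivAt_id v).const_mul (deriv F x))).sub
      (((hasDerivAt_id v).pow 2).const_mul (D / 2))
    refine h3.congr_deriv ?_
    simp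
    ring
  have hbound : ∀ v ∈ Metric.closedBall (0 : ℝ) |u|,
      ‖deriv F (x + v) - deriv F x - v • D‖ ≤ ε * |u| := by
    intro v hv
    have hv' : v ∈ Metric.ball (0 : ℝ) δ := by
      rw [mem_closedBall_zero_iff] at hv
      rw [mem_ball_zero_iff] at hu ⊢
      exact hv.trans_lt hu
    rw [mem_closedBall_zero_iff] at hv
    exact (hball v hv').1.trans (mul_le_mul_of_nonneg_left hv hε.le)
  have := (convex_closedBall (0 : ℝ) |u|).norm_image_sub_le_of_norm_hasDerivWithin_le
    (fun v hv => (hder v hv).hasDerivWithinAt) hbound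
    (Metric.mem_closedBall_self (abs_nonneg u)) (show u ∈ Metric.closedBall (0 : ℝ) |u| by simp)
  have hG0 : G 0 = 0 := by simp [hG]
  rw [hG0, sub_zero, sub_zero] at this
  refine this.trans (le_of_eq ?_)
  rw [norm_pow, Real.norm_eq_abs]; ring

/-- Second-order bias of a kernel smoother with a kernel of order two. -/
theorem tendsto_kernel_bias {K F : ℝ → ℝ} (hK : A1 K) (hF : Measurable F) {C x : ℝ}
    (hC : ∀ s, |F s| ≤ C) (hF2 : TwiceDifferentiableAt F x) {h : ℕ → ℝ} (hpos : ∀ n, 0 < h n)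
    (hh : Tendsto h atTop (𝓝 0)) :
    Tendsto (fun n => ((∫ z, K z * F (x - h n * z)) - F x) / h n ^ 2) atTop
      (𝓝 (iteratedDeriv 2 F x / 2 * kernelMoment 2 K)) := by
  set d := deriv F x with hd
  set D := iteratedDeriv 2 F x with hD
  set ρ : ℝ → ℝ := fun u => F (x + u) - F x - d * u with hρ
  have hρm : Measurable ρ := by fun_prop
  have hlit := hF2.isLittleO
  -- A global quadratic bound is needed for dominated convergence against z² K(z). Near 0 it is the
  -- Taylor expansion; for |u| ≥ δ it follows from boundedness of F, since 1 ≤ u²/δ² and |u| ≤ u²/δ.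
  obtain ⟨B, hB⟩ : ∃ B, ∀ u, |ρ u| ≤ B * u ^ 2 := by
    obtain ⟨δ, hδ, hball⟩ := Metric.eventually_nhds_iff_ball.1
      (Asymptotics.isLittleO_iff.1 hlit one_pos)
    have hC0 : 0 ≤ C := (abs_nonneg _).trans (hC x)
    refine ⟨(1 + |D| / 2) + (2 * C / δ ^ 2 + |d| / δ), fun u => ?_⟩
    have p1 : 0 ≤ (1 + |D| / 2) * u ^ 2 := by positivity
    have p2 : 0 ≤ (2 * C / δ ^ 2 + |d| / δ) * u ^ 2 := by positivity
    rw [add_mul]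
    rcases lt_or_ge |u| δ with hu | hu
    · have h1 := hball u (by rwa [mem_ball_zero_iff, Real.norm_eq_abs])
      rw [Real.norm_eq_abs, Real.norm_eq_abs, abs_of_nonneg (sq_nonneg u), one_mul] at h1
      have h2 : |ρ u| ≤ |ρ u - D / 2 * u ^ 2| + |D / 2 * u ^ 2| := by
        have := abs_add_le (ρ u - D / 2 * u ^ 2) (D / 2 * u ^ 2)
        rwa [sub_add_cancel] at this
      have h3 : |D / 2 * u ^ 2| = |D| / 2 * u ^ 2 := by
        rw [abs_mul, abs_div, abs_of_nonneg (sq_nonneg u)]; norm_num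
      rw [h3] at h2
      have h4 : |ρ u - D / 2 * u ^ 2| ≤ u ^ 2 := h1
      linarith
    · have hu0 : 0 < |u| := hδ.trans_le hu
      have h1 : |ρ u| ≤ |F (x + u)| + |F x| + |d| * |u| := by
        refine (abs_sub _ _).trans ?_
        rw [abs_mul]
        have := abs_sub (F (x + u)) (F x)
        linarith
      have h2 : 2 * C ≤ 2 * C / δ ^ 2 * u ^ 2 := by
        rw [div_mul_eq_mul_div, le_div_iff₀ (by positivity)]
        have : δ ^ 2 ≤ u ^ 2 := by rw [← sq_abs u]; exact pow_le_pow_left₀ hδ.le hu 2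
        exact mul_le_mul_of_nonneg_left this (by positivity)
      have h3 : |d| * |u| ≤ |d| / δ * u ^ 2 := by
        rw [div_mul_eq_mul_div, le_div_iff₀ hδ, ← sq_abs u, sq, ← mul_assoc]
        exact mul_le_mul_of_nonneg_left hu (by positivity)
      have := hC (x + u)
      have := hC x
      rw [add_mul] at p2 ⊢
      linarith
  have hzK : Integrable fun z => z * K z := by
    refine (hK.integrable.norm.add hK.integrable_sq_mul.norm).mono'
      (measurable_id.mul hK.cont.measurable).aestronglyMeasurable (Eventually.of_forall fun z => ?_)
    simp only [Pi.add_apply, norm_mul, norm_pow, Real.norm_eq_abs]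
    have h1 : |z| ≤ 1 + |z| ^ 2 := by nlinarith [sq_nonneg (|z| - 1)]
    have := mul_le_mul_of_nonneg_right h1 (abs_nonneg (K z))
    linarith
  have hKF : ∀ n, Integrable fun z => K z * F (x - h n * z) := fun n =>
    (hK.integrable.norm.mul_const C).mono'
      (hK.cont.measurable.mul (hF.comp (by fun_prop))).aestronglyMeasurable
      (Eventually.of_forall fun z => by
        rw [norm_mul]; exact mul_le_mul_of_nonneg_left (hC _) (norm_nonneg _))
  -- Subtracting the constant and linear terms under the integral is exact because ∫ K = 1 and ∫ z K
  -- = 0.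
  have hrew : ∀ n, ((∫ z, K z * F (x - h n * z)) - F x) / h n ^ 2 =
      ∫ z, K z * (ρ (-(h n * z)) / h n ^ 2) := by
    intro n
    have e1 : ∀ z, K z * (ρ (-(h n * z)) / h n ^ 2) =
        (K z * F (x - h n * z) - F x * K z + d * h n * (z * K z)) / h n ^ 2 := fun z => by
      simp only [hρ, ← sub_eq_add_neg]; ring
    simp_rw [e1]
    have i1 : Integrable fun z => K z * F (x - h n * z) - F x * K z :=
      (hKF n).sub (hK.integrable.const_mul _)
    rw [integral_div, integral_add i1 (hzK.const_mul _),
      integral_sub (hKF n) (hK.integrable.const_mul _), integral_const_mul, integral_const_mul,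
      hK.integral_eq_one, hK.integral_mul_eq_zero]
    ring
  simp_rw [hrew]
  rw [kernelMoment, ← integral_const_mul]
  refine tendsto_integral_of_dominated_convergence (fun z => B * ‖z ^ 2 * K z‖)
    (fun n => (hK.cont.measurable.mul ((hρm.comp (by fun_prop)).div_const _)).aestronglyMeasurable)
    (hK.integrable_sq_mul.norm.const_mul B) (fun n => Eventually.of_forall fun z => ?_)
    (Eventually.of_forall fun z => ?_)
  · have hp := hpos n
    rw [norm_mul, norm_mul, norm_div, norm_pow, norm_pow, Real.norm_eq_abs, Real.norm_eq_abs,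
      Real.norm_eq_abs, Real.norm_eq_abs, sq_abs, sq_abs]
    have h1 : |ρ (-(h n * z))| / h n ^ 2 ≤ B * z ^ 2 := by
      rw [div_le_iff₀ (by positivity)]
      refine (hB _).trans (le_of_eq ?_)
      ring
    refine (mul_le_mul_of_nonneg_left h1 (abs_nonneg (K z))).trans (le_of_eq ?_)
    ring
  · have hu : Tendsto (fun n => -(h n * z)) atTop (𝓝 0) := by
      simpa using (hh.mul_const z).neg
    have h1 : Tendsto (fun n => (ρ (-(h n * z)) - D / 2 * (-(h n * z)) ^ 2) / h n ^ 2) atTop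
        (𝓝 0) := by
      have h2 := hlit.comp_tendsto hu
      have h3 : (fun n => (-(h n * z)) ^ 2) =O[atTop] fun n => h n ^ 2 := by
        refine Asymptotics.IsBigO.of_bound (z ^ 2) (Eventually.of_forall fun n => ?_)
        rw [norm_pow, norm_pow, Real.norm_eq_abs, Real.norm_eq_abs, sq_abs, sq_abs]
        apply le_of_eq; ring
      exact (h2.trans_isBigO h3).tendsto_div_nhds_zero
    have h2 : Tendsto (fun n => K z * ((ρ (-(h n * z)) - D / 2 * (-(h n * z)) ^ 2) / h n ^ 2 +
        D / 2 * z ^ 2)) atTop (𝓝 (K z * (0 + D / 2 * z ^ 2))) := (h1.add_const _).const_mul _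
    convert h2 using 2 with n
    · have := (hpos n).ne'
      field_simp
      ring
    · ring

end Smoothing

/-! ### Moments of the summands of the two estimators -/

section Terms

variable {Ω : Type*}

/-- The summand `h⁻¹ Y K((x - X) / h)` of the numerator. -/
def numTerm (K : ℝ → ℝ) (h : ℕ → ℝ) (x : ℝ) (X Y : ℕ → Ω → ℝ) (k : ℕ) (ω : Ω) : ℝ :=
  (h (k + 1))⁻¹ * Y (k + 1) ω * K ((h (k + 1))⁻¹ * (x - X (k + 1) ω))

/-- The summand `h⁻¹ K((x - X) / h)` of the denominator. -/
def denTerm (K : ℝ → ℝ) (h : ℕ → ℝ) (x : ℝ) (X : ℕ → Ω → ℝ) (k : ℕ) (ω : Ω) : ℝ :=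
  (h (k + 1))⁻¹ * K ((h (k + 1))⁻¹ * (x - X (k + 1) ω))

/-- Two jointly independent sequences of variables with the moment asymptotics of kernel
estimators with bandwidth `h`: means `A + A₂ h²`, `F + F₂ h²`, second moments
`v / h`, and third absolute moments `O(h⁻²)`. -/
structure KernelMoments [MeasurableSpace Ω] (P : Measure Ω) (h : ℕ → ℝ) (T U : ℕ → Ω → ℝ)
    (A F A₂ F₂ vTT vTU vUU C : ℝ) : Prop where
  meas_T : ∀ k, Measurable (T k)
  meas_U : ∀ k, Measurable (U k)
  indep : iIndepFun (fun k ω => (T k ω, U k ω)) P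
  integrable_T : ∀ k, Integrable (fun ω => |T k ω| ^ 3) P
  integrable_U : ∀ k, Integrable (fun ω => |U k ω| ^ 3) P
  mean_T : Tendsto (fun k => ((∫ ω, T k ω ∂P) - A) / h (k + 1) ^ 2) atTop (𝓝 A₂)
  mean_U : Tendsto (fun k => ((∫ ω, U k ω ∂P) - F) / h (k + 1) ^ 2) atTop (𝓝 F₂)
  second_TT : Tendsto (fun k => h (k + 1) * ∫ ω, T k ω ^ 2 ∂P) atTop (𝓝 vTT)
  second_TU : Tendsto (fun k => h (k + 1) * ∫ ω, T k ω * U k ω ∂P) atTop (𝓝 vTU)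
  second_UU : Tendsto (fun k => h (k + 1) * ∫ ω, U k ω ^ 2 ∂P) atTop (𝓝 vUU)
  third_T : ∀ k, h (k + 1) ^ 2 * ∫ ω, |T k ω| ^ 3 ∂P ≤ C
  third_U : ∀ k, h (k + 1) ^ 2 * ∫ ω, |U k ω| ^ 3 ∂P ≤ C

end Terms

theorem A1.integrable_pow {K : ℝ → ℝ} (hK : A1 K) {p : ℕ} (hp : 1 ≤ p) :
    Integrable fun z => K z ^ p := by
  obtain ⟨C, hC⟩ := hK.bounded
  refine (hK.integrable.norm.const_mul (C ^ (p - 1))).mono'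
    (hK.cont.pow p).aestronglyMeasurable (Eventually.of_forall fun z => ?_)
  rw [norm_pow, Real.norm_eq_abs]
  obtain ⟨m, rfl⟩ : ∃ m, p = m + 1 := ⟨p - 1, by omega⟩
  rw [pow_succ, Nat.add_sub_cancel]
  exact mul_le_mul_of_nonneg_right (pow_le_pow_left₀ (abs_nonneg _) (hC z) m) (abs_nonneg _)

theorem measurable_mom {g : ℝ → ℝ → ℝ} (hg : Measurable (fun p : ℝ × ℝ => g p.1 p.2)) (q : ℕ) :
    Measurable (mom g q) := by
  have h1 : StronglyMeasurable fun p : ℝ × ℝ => p.2 ^ q * g p.1 p.2 :=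
    ((measurable_snd.pow_const q).mul hg).stronglyMeasurable
  exact (h1.integral_prod_right (ν := (volume : Measure ℝ))).measurable

/-- One bound serves q = 0, 1, 2 because |t|^q ≤ 1 + t²; it covers the absolute first moment. -/
theorem A3.abs_mom_le {g : ℝ → ℝ → ℝ} {x : ℝ} (h3 : A3 g x) (hg0 : ∀ s t, 0 ≤ g s t) :
    ∃ C : ℝ, ∀ q : ℕ, q ≤ 2 → ∀ s, ∫ t, |t ^ q| * g s t ≤ C := by
  obtain ⟨C0, hC0⟩ := h3.bounded_mom 0 (by norm_num)
  obtain ⟨C2, hC2⟩ := h3.bounded_mom 2 (by norm_num)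
  refine ⟨C0 + C2, fun q hq s => ?_⟩
  have i0 := h3.integrable_mom 0 (by norm_num) s
  have i2 := h3.integrable_mom 2 (by norm_num) s
  have iq : Integrable fun t => |t ^ q| * g s t := by
    refine (h3.integrable_mom q hq s).norm.congr (Eventually.of_forall fun t => ?_)
    simp only
    rw [norm_mul, Real.norm_eq_abs, Real.norm_of_nonneg (hg0 s t)]
  have hle : ∫ t, |t ^ q| * g s t ≤ ∫ t, (t ^ 0 * g s t + t ^ 2 * g s t) := by
    refine integral_mono iq (i0.add i2) fun t => ?_
    simp only
    rw [← add_mul]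
    refine mul_le_mul_of_nonneg_right ?_ (hg0 s t)
    rw [abs_pow, pow_zero, ← sq_abs]
    interval_cases q
    · rw [pow_zero]; nlinarith [sq_nonneg |t|]
    · rw [pow_one]; nlinarith [sq_nonneg (|t| - 1)]
    · linarith
  rw [integral_add i0 i2] at hle
  have h0 := (le_abs_self _).trans (hC0 s)
  have h2 := (le_abs_self _).trans (hC2 s)
  simp only [mom] at h0 h2
  linarith

section Moments

variable {Ω : Type*} [MeasurableSpace Ω] {P : Measure Ω} {X Y : ℕ → Ω → ℝ} {g : ℝ → ℝ → ℝ}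
  {K : ℝ → ℝ} {h : ℕ → ℝ} {x a : ℝ}

theorem IsSample.integral_pow_mul_pow (hXY : IsSample P X Y g) (hK : A1 K) (h3 : A3 g x)
    (hpos : ∀ n, 1 ≤ n → 0 < h n) {q p : ℕ} (hq : q ≤ 2) (hp : 1 ≤ p) (k : ℕ) :
    ∫ ω, Y (k + 1) ω ^ q * K ((h (k + 1))⁻¹ * (x - X (k + 1) ω)) ^ p ∂P =
        h (k + 1) * ∫ z, K z ^ p * mom g q (x - h (k + 1) * z) := by
  obtain ⟨C, hC⟩ := h3.abs_mom_le hXY.nonneg_g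
  have := (integral_kernel_mul (hXY.meas_X (k + 1) (by omega)) (hXY.meas_Y (k + 1) (by omega))
    hXY.meas_g hXY.nonneg_g (hXY.law (k + 1) (by omega)) (φ := fun z => K z ^ p)
    (τ := fun t => t ^ q) (hK.cont.pow p).measurable (hK.integrable_pow hp)
    (measurable_id.pow_const q) (h3.integrable_mom q hq) (hC q hq) x (hpos (k + 1) (by omega))).2
  exact this

theorem IsSample.abs_pow_mul_cube (hXY : IsSample P X Y g) (hK : A1 K) (h3 : A3 g x)
    (hpos : ∀ n, 1 ≤ n → 0 < h n) {q : ℕ} (hq : q = 0 ∨ q = 3) :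
    ∃ C : ℝ, ∀ k,
      Integrable (fun ω => |Y (k + 1) ω| ^ q * |K ((h (k + 1))⁻¹ * (x - X (k + 1) ω))| ^ 3) P ∧
      ∫ ω, |Y (k + 1) ω| ^ q * |K ((h (k + 1))⁻¹ * (x - X (k + 1) ω))| ^ 3 ∂P ≤ h (k + 1) * C := by
  obtain ⟨C, hi, hC⟩ : ∃ C : ℝ, (∀ s, Integrable fun t => |t| ^ q * g s t) ∧
      ∀ s, ∫ t, |t| ^ q * g s t ≤ C := by
    rcases hq with rfl | rfl
    · obtain ⟨C, hC⟩ := h3.bounded_mom 0 (by norm_num)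
      refine ⟨C, fun s => ?_, fun s => ?_⟩
      · simpa using h3.integrable_mom 0 (by norm_num) s
      · have := (le_abs_self _).trans (hC s)
        simpa [mom] using this
    · obtain ⟨C, hC⟩ := h3.bounded_absMom 3 (by norm_num) le_rfl
      have e : ∀ t : ℝ, |t| ^ (3 : ℝ) = |t| ^ 3 := fun t => by
        rw [← Real.rpow_natCast]; norm_num
      refine ⟨C, fun s => ?_, fun s => ?_⟩
      · simpa only [e] using h3.integrable_absMom 3 (by norm_num) le_rfl s
      · simpa only [e] using hC s
  have hK3 : Integrable fun z => |K z| ^ 3 := by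
    refine (hK.integrable_pow (p := 3) (by norm_num)).norm.congr (Eventually.of_forall fun z => ?_)
    simp only [norm_pow, Real.norm_eq_abs]
  refine ⟨∫ z, |K z| ^ 3 * C, fun k => ?_⟩
  have hC' : ∀ s, ∫ t, |(|t| ^ q)| * g s t ≤ C := fun s => by
    simpa only [abs_pow, abs_abs] using hC s
  have hk := hpos (k + 1) (by omega)
  obtain ⟨h1, h2⟩ := integral_kernel_mul (hXY.meas_X (k + 1) (by omega))
    (hXY.meas_Y (k + 1) (by omega))
    hXY.meas_g hXY.nonneg_g (hXY.law (k + 1) (by omega)) (φ := fun z => |K z| ^ 3)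
    (τ := fun t => |t| ^ q) (hK.cont.abs.pow 3).measurable hK3
    (continuous_abs.pow q).measurable hi hC' x hk
  refine ⟨h1, ?_⟩
  rw [h2]
  refine mul_le_mul_of_nonneg_left ?_ hk.le
  refine integral_mono_of_nonneg (Eventually.of_forall fun z => ?_) (hK3.mul_const C)
    (Eventually.of_forall fun z => ?_)
  · exact mul_nonneg (by positivity) (integral_nonneg fun t =>
      mul_nonneg (by positivity) (hXY.nonneg_g _ _))
  · exact mul_le_mul_of_nonneg_left (hC _) (by positivity)

/-- The interface between the sampling model and the limit theorems: afterwards only these moment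
asymptotics and independence are used. Second moments of orders q = 2, 1, 0 in Y give the limits for
T², TU and U². -/
theorem IsSample.kernelMoments (hXY : IsSample P X Y g) (hK : A1 K) (h3 : A3 g x)
    (hpos : ∀ n, 1 ≤ n → 0 < h n) (hh : Tendsto h atTop (𝓝 0))
    (hf2 : TwiceDifferentiableAt (dens g) x) (ha2 : TwiceDifferentiableAt (afun g) x) :
    ∃ C, KernelMoments P h (numTerm K h x X Y) (denTerm K h x X) (afun g x) (dens g x)
      (iteratedDeriv 2 (afun g) x / 2 * kernelMoment 2 K)
      (iteratedDeriv 2 (dens g) x / 2 * kernelMoment 2 K)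
      (mom g 2 x * R K) (afun g x * R K) (dens g x * R K) C := by
  obtain ⟨CT, hCT⟩ := hXY.abs_pow_mul_cube hK h3 hpos (q := 3) (Or.inr rfl)
  obtain ⟨CU, hCU⟩ := hXY.abs_pow_mul_cube hK h3 hpos (q := 0) (Or.inl rfl)
  have hh' : Tendsto (fun k => h (k + 1)) atTop (𝓝 0) := (tendsto_add_atTop_iff_nat 1).2 hh
  have hpos' : ∀ k, 0 < h (k + 1) := fun k => hpos (k + 1) (by omega)
  have eT3 : ∀ k ω, |numTerm K h x X Y k ω| ^ 3 = (h (k + 1))⁻¹ ^ 3 *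
      (|Y (k + 1) ω| ^ 3 * |K ((h (k + 1))⁻¹ * (x - X (k + 1) ω))| ^ 3) := fun k ω => by
    rw [numTerm, abs_mul, abs_mul, abs_of_pos (inv_pos.2 (hpos' k))]; ring
  have eU3 : ∀ k ω, |denTerm K h x X k ω| ^ 3 = (h (k + 1))⁻¹ ^ 3 *
      (|Y (k + 1) ω| ^ 0 * |K ((h (k + 1))⁻¹ * (x - X (k + 1) ω))| ^ 3) := fun k ω => by
    rw [denTerm, abs_mul, abs_of_pos (inv_pos.2 (hpos' k))]; ring
  have mean : ∀ q ≤ 1, TwiceDifferentiableAt (mom g q) x → Tendsto (fun k =>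
      ((∫ ω, (h (k + 1))⁻¹ * (Y (k + 1) ω ^ q * K ((h (k + 1))⁻¹ * (x - X (k + 1) ω)) ^ 1) ∂P) -
        mom g q x) / h (k + 1) ^ 2) atTop
      (𝓝 (iteratedDeriv 2 (mom g q) x / 2 * kernelMoment 2 K)) := by
    intro q hq hF
    obtain ⟨C, hC⟩ := h3.bounded_mom q (by omega)
    refine (tendsto_kernel_bias hK (measurable_mom hXY.meas_g q) hC hF hpos' hh').congr fun k => ?_
    rw [integral_const_mul, hXY.integral_pow_mul_pow hK h3 hpos (by omega) le_rfl,
      inv_mul_cancel_left₀ (hpos' k).ne']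
    simp only [pow_one]
  have second : ∀ q ≤ 2, Tendsto (fun k => h (k + 1) *
      ∫ ω, (h (k + 1))⁻¹ ^ 2 * (Y (k + 1) ω ^ q * K ((h (k + 1))⁻¹ * (x - X (k + 1) ω)) ^ 2) ∂P)
      atTop (𝓝 (mom g q x * R K)) := by
    intro q hq
    obtain ⟨C, hC⟩ := h3.bounded_mom q hq
    refine (tendsto_integral_kernel (hK.integrable_pow (p := 2) (by norm_num))
      (measurable_mom hXY.meas_g q) hC (h3.cont_mom q hq) hh').congr fun k => ?_
    rw [integral_const_mul, hXY.integral_pow_mul_pow hK h3 hpos hq (by norm_num)]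
    have := (hpos' k).ne'
    field_simp
  refine ⟨max CT CU, ?_, ?_, ?_, fun k => ?_, fun k => ?_, ?_, ?_, ?_, ?_, ?_, fun k => ?_,
    fun k => ?_⟩
  · intro k
    have := hXY.meas_X (k + 1) (by omega)
    have := hXY.meas_Y (k + 1) (by omega)
    have := hK.cont.measurable
    unfold numTerm
    fun_prop
  · intro k
    have := hXY.meas_X (k + 1) (by omega)
    have := hK.cont.measurable
    unfold denTerm
    fun_prop
  · have := hK.cont.measurable
    exact hXY.indep.comp (fun k p => ((h (k + 1))⁻¹ * p.2 * K ((h (k + 1))⁻¹ * (x - p.1)),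
      (h (k + 1))⁻¹ * K ((h (k + 1))⁻¹ * (x - p.1)))) (fun k => by fun_prop)
  · simp_rw [eT3]; exact (hCT k).1.const_mul _
  · simp_rw [eU3]; exact (hCU k).1.const_mul _
  · refine (mean 1 le_rfl ha2).congr fun k => ?_
    simp only [pow_one, numTerm, mul_assoc, afun]
  · refine (mean 0 (by norm_num) hf2).congr fun k => ?_
    simp only [pow_one, pow_zero, one_mul, denTerm, dens]
  · refine (second 2 le_rfl).congr fun k => ?_
    simp only [numTerm, mul_pow, mul_assoc]
  · refine (second 1 (by norm_num)).congr fun k => ?_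
    congr 2; ext ω
    simp only [numTerm, denTerm]; ring
  · refine (second 0 (by norm_num)).congr fun k => ?_
    simp only [denTerm, mul_pow, pow_zero, one_mul]
  · simp_rw [eT3]
    rw [integral_const_mul]
    have hk := hpos' k
    calc h (k + 1) ^ 2 * ((h (k + 1))⁻¹ ^ 3 * _)
        = (h (k + 1))⁻¹ * _ := by rw [← mul_assoc]; congr 1; field_simp
      _ ≤ (h (k + 1))⁻¹ * (h (k + 1) * CT) :=
        mul_le_mul_of_nonneg_left (hCT k).2 (inv_pos.2 hk).le
      _ = CT := inv_mul_cancel_left₀ hk.ne' _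
      _ ≤ _ := le_max_left _ _
  · simp_rw [eU3]
    rw [integral_const_mul]
    have hk := hpos' k
    calc h (k + 1) ^ 2 * ((h (k + 1))⁻¹ ^ 3 * _)
        = (h (k + 1))⁻¹ * _ := by rw [← mul_assoc]; congr 1; field_simp
      _ ≤ (h (k + 1))⁻¹ * (h (k + 1) * CU) :=
        mul_le_mul_of_nonneg_left (hCU k).2 (inv_pos.2 hk).le
      _ = CU := inv_mul_cancel_left₀ hk.ne' _
      _ ≤ _ := le_max_right _ _

end Moments

/-! ### Weights of the stochastic approximation recursions -/

/-- The weight of the `k`-th summand (counted from `0`) after `n` steps of the recursion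
`z_{n+1} = (1 - s_{n+1}) z_n + s_{n+1} T_n`. -/
def weight (s : ℕ → ℝ) : ℕ → ℕ → ℝ
  | 0, _ => 0
  | n + 1, k => if k = n then s (n + 1) else (1 - s (n + 1)) * weight s n k

/-- One step damps all old weights and adds one new weight. Leaving G arbitrary yields the
recursions for first-order, mixed second-order and third-order sums at once. -/
theorem sum_weight_succ (s s' : ℕ → ℝ) (G : ℝ → ℝ → ℕ → ℝ) (n : ℕ) :
    ∑ k ∈ Finset.range (n + 1), G (weight s (n + 1) k) (weight s' (n + 1) k) k =
      ∑ k ∈ Finset.range n, G ((1 - s (n + 1)) * weight s n k) ((1 - s' (n + 1)) * weight s' n k) k +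
        G (s (n + 1)) (s' (n + 1)) n := by
  rw [Finset.sum_range_succ]
  congr 1
  · refine Finset.sum_congr rfl fun k hk => ?_
    have : k ≠ n := (Finset.mem_range.1 hk).ne
    simp [weight, this]
  · simp [weight]

theorem sum_weight_mul_succ (s q : ℕ → ℝ) (n : ℕ) :
    ∑ k ∈ Finset.range (n + 1), weight s (n + 1) k * q k =
      (1 - s (n + 1)) * ∑ k ∈ Finset.range n, weight s n k * q k + s (n + 1) * q n := by
  rw [sum_weight_succ s s (fun w _ k => w * q k), Finset.mul_sum]
  simp only [mul_assoc]

theorem aEst_eq_sum {Ω : Type*} (K : ℝ → ℝ) (h : ℕ → ℝ) (x : ℝ) (βs : ℕ → ℝ) (X Y : ℕ → Ω → ℝ)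
    (n : ℕ) (ω : Ω) : aEst K h x βs X Y n ω =
      ∑ k ∈ Finset.range n, weight βs n k * numTerm K h x X Y k ω := by
  induction n with
  | zero => simp [aEst]
  | succ n ih => rw [sum_weight_mul_succ βs (fun k => numTerm K h x X Y k ω), ← ih]; rfl

theorem fEst_eq_sum {Ω : Type*} (K : ℝ → ℝ) (h : ℕ → ℝ) (x : ℝ) (γs : ℕ → ℝ) (X : ℕ → Ω → ℝ)
    (n : ℕ) (ω : Ω) : fEst K h x γs X n ω =
      ∑ k ∈ Finset.range n, weight γs n k * denTerm K h x X k ω := by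
  induction n with
  | zero => simp [fEst]
  | succ n ih => rw [sum_weight_mul_succ γs (fun k => denTerm K h x X k ω), ← ih]; rfl

namespace StepSize

variable {ξ κ : ℝ} {s s' u q : ℕ → ℝ}

/-- The update averages old value and new input, so subtracting A commutes with it; damping rate m =
1. -/
theorem tendsto_sum_weight_sub (hs : StepSize ξ s) (hu : LogGS κ u) {A w : ℝ}
    (hq : Tendsto (fun n => (q n - A) / u (n + 1)) atTop (𝓝 w)) (hpos : 0 < 1 + κ * ξ) :
    Tendsto (fun n => (∑ k ∈ Finset.range n, weight s n k * q k - A) / u n) atTop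
      (𝓝 (w / (1 + κ * ξ))) := by
  refine hs.tendsto_div_of_rec hu (m := fun _ => 1) (q := fun n => q n - A)
    (Eventually.of_forall fun n => ?_) tendsto_const_nhds hq hpos
  rw [sum_weight_mul_succ]; ring

/-- Products of weights are damped by (1 - s)(1 - s') = 1 - s (1 + s'/s - s'), so m tends to 1 + ρ.
-/
theorem tendsto_sum_weight_mul_weight (hs : StepSize ξ s) (hs' : Tendsto s' atTop (𝓝 0))
    (hu : LogGS κ u) {ρ w : ℝ} (hρ : Tendsto (fun n => s' n / s n) atTop (𝓝 ρ))
    (hq : Tendsto (fun n => s' (n + 1) * q n / u (n + 1)) atTop (𝓝 w))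
    (hpos : 0 < 1 + ρ + κ * ξ) :
    Tendsto (fun n => (∑ k ∈ Finset.range n, weight s n k * weight s' n k * q k) / u n) atTop
      (𝓝 (w / (1 + ρ + κ * ξ))) := by
  refine hs.tendsto_div_of_rec hu
    (m := fun n => 1 + s' (n + 1) / s (n + 1) - s' (n + 1)) (q := fun n => s' (n + 1) * q n)
    (Eventually.of_forall fun n => ?_) ?_ hq hpos
  · have hsn := (hs.pos (n + 1) (by omega)).ne'
    rw [sum_weight_succ s s' (fun w w' k => w * w' * q k)]
    have e1 : 1 - s (n + 1) * (1 + s' (n + 1) / s (n + 1) - s' (n + 1)) =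
        (1 - s (n + 1)) * (1 - s' (n + 1)) := by
      field_simp
      ring
    rw [e1, Finset.mul_sum]
    congr 1
    · refine Finset.sum_congr rfl fun k _ => ?_
      ring
    · ring
  · have h1 := (tendsto_add_atTop_iff_nat 1).2 hρ
    have h2 := (tendsto_add_atTop_iff_nat 1).2 hs'
    simpa using (h1.const_add 1).sub h2

/-- The damping factor is (1 - s)³ = 1 - s (3 - 3s + s²), so m tends to 3. The absolute value is
harmless once s < 1. -/
theorem tendsto_sum_abs_weight_cube (hs : StepSize ξ s) (hu : LogGS κ u)
    (hq : Tendsto (fun n => s (n + 1) ^ 2 * q n / u (n + 1)) atTop (𝓝 0))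
    (hpos : 0 < 3 + κ * ξ) :
    Tendsto (fun n => (∑ k ∈ Finset.range n, |weight s n k| ^ 3 * q k) / u n) atTop (𝓝 0) := by
  have := hs.tendsto_div_of_rec hu (m₀ := 3) (w₀ := 0)
    (z := fun n => ∑ k ∈ Finset.range n, |weight s n k| ^ 3 * q k)
    (m := fun n => 3 - 3 * s (n + 1) + s (n + 1) ^ 2) (q := fun n => s (n + 1) ^ 2 * q n)
    ?_ ?_ hq hpos
  · simpa using this
  · filter_upwards [((tendsto_add_atTop_iff_nat 1).2 hs.tendsto_zero).eventually
      (gt_mem_nhds one_pos)] with n hn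
    rw [sum_weight_succ s s (fun w _ k => |w| ^ 3 * q k)]
    have e1 : 1 - s (n + 1) * (3 - 3 * s (n + 1) + s (n + 1) ^ 2) = (1 - s (n + 1)) ^ 3 := by ring
    rw [e1, Finset.mul_sum]
    congr 1
    · refine Finset.sum_congr rfl fun k _ => ?_
      rw [abs_mul, abs_of_pos (by linarith : 0 < 1 - s (n + 1))]; ring
    · rw [abs_of_pos (hs.pos (n + 1) (by omega))]; ring
  · have h2 := (tendsto_add_atTop_iff_nat 1).2 hs.tendsto_zero
    simpa using ((h2.const_mul 3).const_sub 3).add (h2.pow 2)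

end StepSize

/-! ### Weighted sums of independent variables -/

section Sums

variable {Ω : Type*} [MeasurableSpace Ω] {P : Measure Ω} [IsProbabilityMeasure P]

theorem memLp_two_of_cube {Z : Ω → ℝ} (hZ : AEStronglyMeasurable Z P)
    (h3 : Integrable (fun ω => |Z ω| ^ 3) P) : MemLp Z 2 P :=
  (memLp_two_iff_integrable_sq hZ).2 (integrable_pow_of_cube hZ h3 (by norm_num))

/-- Mean square error of a sum of independent variables: variance plus squared bias. -/
theorem integral_sum_sub_sq {L : ℕ → Ω → ℝ} (hind : iIndepFun L P) (hL : ∀ k, MemLp (L k) 2 P)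
    (c : ℝ) (n : ℕ) :
    ∫ ω, (∑ k ∈ Finset.range n, L k ω - c) ^ 2 ∂P =
      ∑ k ∈ Finset.range n, Var[L k; P] + (∑ k ∈ Finset.range n, (∫ ω, L k ω ∂P) - c) ^ 2 := by
  have hS : MemLp (∑ k ∈ Finset.range n, L k) 2 P := memLp_finsetSum' _ fun k _ => hL k
  have h1 : Var[∑ k ∈ Finset.range n, L k; P] = ∑ k ∈ Finset.range n, Var[L k; P] :=
    IndepFun.variance_sum (fun k _ => hL k) fun i _ j _ hij => hind.indepFun hij
  have hSc : MemLp (fun ω => (∑ k ∈ Finset.range n, L k) ω - c) 2 P := hS.sub (memLp_const c)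
  have h2 := variance_sub_const hS.aestronglyMeasurable c (μ := P)
  rw [variance_eq_sub hSc, h1] at h2
  have h3 : ∫ ω, ((∑ k ∈ Finset.range n, L k) ω - c) ∂P =
      ∑ k ∈ Finset.range n, (∫ ω, L k ω ∂P) - c := by
    rw [integral_sub (hS.integrable one_le_two) (integrable_const _)]
    simp only [Finset.sum_apply]
    rw [integral_finsetSum _ fun k _ => (hL k).integrable one_le_two]
    simp
  rw [h3] at h2
  rw [← h2]
  simp

theorem tendstoInMeasure_of_integral_sq {W : ℕ → Ω → ℝ} {c : ℝ}
    (hi : ∀ n, Integrable (fun ω => (W n ω - c) ^ 2) P)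
    (h : Tendsto (fun n => ∫ ω, (W n ω - c) ^ 2 ∂P) atTop (𝓝 0)) :
    TendstoInMeasure P W atTop (fun _ => c) := by
  rw [tendstoInMeasure_iff_measureReal_norm]
  intro ε hε
  have h1 := h.const_mul (ε ^ 2)⁻¹
  rw [mul_zero] at h1
  refine squeeze_zero (fun _ => measureReal_nonneg) (fun n => ?_) h1
  have h2 := mul_meas_ge_le_integral_of_nonneg
    (Eventually.of_forall fun ω => sq_nonneg (W n ω - c)) (hi n) (ε ^ 2)
  rw [← div_eq_inv_mul, le_div_iff₀ (by positivity), mul_comm]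
  refine le_trans (mul_le_mul_of_nonneg_left (measureReal_mono fun ω hω => ?_) (by positivity)) h2
  simp only [Set.mem_ofPred_eq, Real.norm_eq_abs] at hω ⊢
  rw [← sq_abs (W n ω - c)]
  exact pow_le_pow_left₀ hε.le hω 2

/-- Replacing a random denominator by its limit in probability. -/
theorem tendstoInMeasure_mul_ratio_sub {N D : ℕ → Ω → ℝ} {c : ℕ → ℝ} {F r C : ℝ} (hF : 0 < F)
    (hi : ∀ n, Integrable (fun ω => (c n * (N n ω - r * D n ω)) ^ 2) P)
    (hC : ∀ᶠ n in atTop, ∫ ω, (c n * (N n ω - r * D n ω)) ^ 2 ∂P ≤ C)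
    (hD : TendstoInMeasure P D atTop (fun _ => F)) {ρ : ℕ → Ω → ℝ}
    (hρ : ∀ n ω, D n ω ≠ 0 → ρ n ω = N n ω / D n ω) :
    TendstoInMeasure P ((fun n ω => c n * (ρ n ω - r)) -
      fun n ω => F⁻¹ * (c n * (N n ω - r * D n ω))) atTop 0 := by
  have hC0 : 0 ≤ C := by
    obtain ⟨n, hn⟩ := hC.exists
    exact (integral_nonneg fun _ => sq_nonneg _).trans hn
  rw [tendstoInMeasure_iff_measureReal_norm] at hD ⊢
  intro ε hε
  -- With W = c (N - r D) the discrepancy is W (F - D) / (F D). If |D - F| < η ≤ F/2, it is at most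
  -- |W| · 2η/F², so reaching ε requires |W| ≥ M = εF²/(2η), an event of probability at most C/M².
  -- Letting n → ∞ and then η → 0 finishes.
  have key : ∀ η, 0 < η → η ≤ F / 2 → ∀ᶠ n in atTop,
      P.real {ω | ε ≤ ‖((fun n ω => c n * (ρ n ω - r)) -
        fun n ω => F⁻¹ * (c n * (N n ω - r * D n ω))) n ω - (0 : Ω → ℝ) ω‖} ≤
        P.real {ω | η ≤ ‖D n ω - F‖} + C * (2 * η / (ε * F ^ 2)) ^ 2 := by
    intro η hη hηF
    filter_upwards [hC] with n hn
    set M := ε * F ^ 2 / (2 * η) with hM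
    have hM0 : 0 < M := by positivity
    have h2 := mul_meas_ge_le_integral_of_nonneg
      (Eventually.of_forall fun ω => sq_nonneg (c n * (N n ω - r * D n ω))) (hi n) (M ^ 2)
    have h3 : P.real {ω | M ^ 2 ≤ (c n * (N n ω - r * D n ω)) ^ 2} ≤
        C * (2 * η / (ε * F ^ 2)) ^ 2 := by
      have e : (2 * η / (ε * F ^ 2)) ^ 2 = (M ^ 2)⁻¹ := by
        rw [hM, ← inv_pow, inv_div]
      rw [e, ← div_eq_mul_inv, le_div_iff₀ (by positivity), mul_comm]
      exact h2.trans hn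
    refine le_trans (measureReal_mono ?_) ((measureReal_union_le _ _).trans (add_le_add le_rfl h3))
    intro ω hω
    by_contra hcon
    simp only [Set.mem_union, Set.mem_ofPred_eq, not_or, not_le, Real.norm_eq_abs] at hcon hω
    obtain ⟨h4, h5⟩ := hcon
    have hDpos : F / 2 < D n ω := by
      have := (abs_lt.1 h4).1; linarith
    have hD0 : 0 < D n ω := by linarith
    have h6 : |c n * (N n ω - r * D n ω)| < M := by
      rw [← sq_abs] at h5
      exact lt_of_pow_lt_pow_left₀ 2 hM0.le h5
    have e : c n * (ρ n ω - r) - F⁻¹ * (c n * (N n ω - r * D n ω)) =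
        c n * (N n ω - r * D n ω) * ((F - D n ω) / (F * D n ω)) := by
      rw [hρ n ω hD0.ne']
      field_simp
    simp only [Pi.sub_apply, Pi.zero_apply, sub_zero] at hω
    rw [e, abs_mul, abs_div, abs_of_pos (by positivity : 0 < F * D n ω), abs_sub_comm] at hω
    have h7 : |D n ω - F| / (F * D n ω) ≤ η / (F * (F / 2)) := by
      gcongr
    have h8 : |c n * (N n ω - r * D n ω)| * (|D n ω - F| / (F * D n ω)) <
        M * (η / (F * (F / 2))) :=
      mul_lt_mul_of_lt_of_le_of_nonneg_of_pos h6 h7 (abs_nonneg _) (by positivity)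
    have h9 : M * (η / (F * (F / 2))) = ε := by
      rw [hM]; field_simp
    linarith
  rw [Metric.tendsto_atTop']
  intro δ hδ
  obtain ⟨η, hη, hηF, hηδ⟩ : ∃ η, 0 < η ∧ η ≤ F / 2 ∧ C * (2 * η / (ε * F ^ 2)) ^ 2 < δ / 2 := by
    have h1 : Tendsto (fun η : ℝ => C * (2 * η / (ε * F ^ 2)) ^ 2) (𝓝[>] 0) (𝓝 0) := by
      have : ContinuousAt (fun η : ℝ => C * (2 * η / (ε * F ^ 2)) ^ 2) 0 := by fun_prop
      have h2 := this.tendsto.mono_left (nhdsWithin_le_nhds (s := Set.Ioi 0))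
      simpa using h2
    have h2 := (h1.eventually (gt_mem_nhds (half_pos hδ))).and
      ((eventually_nhdsWithin_of_eventually_nhds (ge_mem_nhds (half_pos hF))).and
        self_mem_nhdsWithin)
    obtain ⟨η, a1, a2, a3⟩ := h2.exists
    exact ⟨η, a3, a2, a1⟩
  obtain ⟨N₁, hN₁⟩ := eventually_atTop.1
    ((key η hη hηF).and ((hD η hη).eventually (gt_mem_nhds (half_pos hδ))))
  refine ⟨N₁, fun n hn => ?_⟩
  obtain ⟨a1, a2⟩ := hN₁ n hn.le
  rw [Real.dist_eq, sub_zero, abs_of_nonneg measureReal_nonneg]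
  linarith

end Sums

/-! ### Asymptotics of the numerator minus `r` times the denominator -/

/-- For nonnegative x and y the gap 4(x³ + y³) - (x + y)³ equals 3(x + y)(x - y)². -/
theorem abs_add_pow_three_le (x y : ℝ) : |x + y| ^ 3 ≤ 4 * (|x| ^ 3 + |y| ^ 3) := by
  have h1 : |x + y| ^ 3 ≤ (|x| + |y|) ^ 3 := pow_le_pow_left₀ (abs_nonneg _) (abs_add_le x y) 3
  have hx := abs_nonneg x
  have hy := abs_nonneg y
  have h2 : (|x| + |y|) ^ 3 ≤ 4 * (|x| ^ 3 + |y| ^ 3) := by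
    nlinarith [mul_nonneg (add_nonneg hx hy) (sq_nonneg (|x| - |y|))]
  exact h1.trans h2

theorem tendstoInMeasure_of_sub {Ω : Type*} [MeasurableSpace Ω] {P : Measure Ω}
    [IsProbabilityMeasure P] {W W' : ℕ → Ω → ℝ} {c : ℝ}
    (h : TendstoInMeasure P (W - W') atTop 0) (h' : TendstoInMeasure P W' atTop (fun _ => c)) :
    TendstoInMeasure P W atTop (fun _ => c) := by
  rw [tendstoInMeasure_iff_measureReal_norm] at h h' ⊢
  intro ε hε
  have h1 := (h (ε / 2) (half_pos hε)).add (h' (ε / 2) (half_pos hε))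
  rw [add_zero] at h1
  refine squeeze_zero (fun _ => measureReal_nonneg) (fun n => ?_) h1
  refine (measureReal_mono ?_).trans (measureReal_union_le _ _)
  intro ω hω
  by_contra hcon
  simp only [Set.mem_union, Set.mem_ofPred_eq, not_or, not_le, Pi.sub_apply, Pi.zero_apply,
    sub_zero, Real.norm_eq_abs] at hcon hω
  have := abs_add_le (W n ω - W' n ω) (W' n ω - c)
  rw [sub_add_sub_cancel] at this
  linarith [hcon.1, hcon.2]

/-- The mean satisfies |E Z|³ ≤ (E Z²)^{3/2} ≤ 3 E|Z|³, and 4 (1 + 3) = 16. -/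
theorem abs_centered_cube_le {Ω : Type*} [MeasurableSpace Ω] {P : Measure Ω}
    [IsProbabilityMeasure P] {Z : Ω → ℝ} (hZ : AEStronglyMeasurable Z P)
    (h3 : Integrable (fun ω => |Z ω| ^ 3) P) :
    Integrable (fun ω => |Z ω - ∫ ω, Z ω ∂P| ^ 3) P ∧
      ∫ ω, |Z ω - ∫ ω, Z ω ∂P| ^ 3 ∂P ≤ 16 * ∫ ω, |Z ω| ^ 3 ∂P := by
  set e := ∫ ω, Z ω ∂P with he
  have hle : ∀ ω, |Z ω - e| ^ 3 ≤ 4 * (|Z ω| ^ 3 + |e| ^ 3) := fun ω => by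
    have := abs_add_pow_three_le (Z ω) (-e)
    rwa [abs_neg, ← sub_eq_add_neg] at this
  have hi : Integrable (fun ω => 4 * (|Z ω| ^ 3 + |e| ^ 3)) P :=
    (h3.add (integrable_const _)).const_mul 4
  have hi' : Integrable (fun ω => |Z ω - e| ^ 3) P := by
    refine hi.mono' ?_ (Eventually.of_forall fun ω => ?_)
    · exact ((continuous_abs.comp_aestronglyMeasurable (hZ.sub aestronglyMeasurable_const))).pow 3
    · rw [Real.norm_of_nonneg (by positivity)]; exact hle ω
  refine ⟨hi', (integral_mono hi' hi hle).trans ?_⟩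
  rw [integral_const_mul, integral_add h3 (integrable_const _)]
  have h1 : |e| ≤ √(∫ ω, Z ω ^ 2 ∂P) := by
    refine Real.abs_le_sqrt ?_
    have h2 := variance_nonneg Z P
    rw [variance_eq_sub (memLp_two_of_cube hZ h3)] at h2
    simp only [Pi.pow_apply] at h2
    linarith
  have h2 := (pow_le_pow_left₀ (abs_nonneg e) h1 3).trans (sqrt_second_moment_cube_le hZ h3)
  simp only [integral_const, probReal_univ, one_smul]
  linarith

/-- The summands of `a_n(x) - r f_n(x)`. -/
def residual {Ω : Type*} (s s' : ℕ → ℝ) (r : ℝ) (T U : ℕ → Ω → ℝ) (n k : ℕ) (ω : Ω) : ℝ :=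
  weight s n k * T k ω - r * weight s' n k * U k ω

theorem sum_residual {Ω : Type*} (s s' : ℕ → ℝ) (r : ℝ) (T U : ℕ → Ω → ℝ) (n : ℕ) (ω : Ω) :
    ∑ k ∈ Finset.range n, residual s s' r T U n k ω =
      ∑ k ∈ Finset.range n, weight s n k * T k ω -
        r * ∑ k ∈ Finset.range n, weight s' n k * U k ω := by
  simp only [residual, Finset.sum_sub_distrib, Finset.mul_sum, mul_assoc]

namespace KernelMoments

variable {Ω : Type*} [MeasurableSpace Ω] {P : Measure Ω}
  {h s s' u : ℕ → ℝ} {T U : ℕ → Ω → ℝ} {A F A₂ F₂ vTT vTU vUU C a ξ κ r w : ℝ}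

theorem memLp_T [IsProbabilityMeasure P]
    (km : KernelMoments P h T U A F A₂ F₂ vTT vTU vUU C)
    (k : ℕ) : MemLp (T k) 2 P :=
  memLp_two_of_cube (km.meas_T k).aestronglyMeasurable (km.integrable_T k)

theorem memLp_U [IsProbabilityMeasure P]
    (km : KernelMoments P h T U A F A₂ F₂ vTT vTU vUU C)
    (k : ℕ) : MemLp (U k) 2 P :=
  memLp_two_of_cube (km.meas_U k).aestronglyMeasurable (km.integrable_U k)

theorem measurable_residual (km : KernelMoments P h T U A F A₂ F₂ vTT vTU vUU C)
    (n k : ℕ) : Measurable (residual s s' r T U n k) :=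
  ((km.meas_T k).const_mul _).sub ((km.meas_U k).const_mul _)

theorem memLp_residual [IsProbabilityMeasure P]
    (km : KernelMoments P h T U A F A₂ F₂ vTT vTU vUU C)
    (n k : ℕ) : MemLp (residual s s' r T U n k) 2 P :=
  ((km.memLp_T k).const_mul _).sub ((km.memLp_U k).const_mul _)

theorem iIndepFun_residual (km : KernelMoments P h T U A F A₂ F₂ vTT vTU vUU C)
    (n : ℕ) : iIndepFun (residual s s' r T U n) P :=
  km.indep.comp (fun k p => weight s n k * p.1 - r * weight s' n k * p.2) fun k => by fun_prop

theorem sum_integral_residual [IsProbabilityMeasure P]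
    (km : KernelMoments P h T U A F A₂ F₂ vTT vTU vUU C)
    (n : ℕ) :
    ∑ k ∈ Finset.range n, ∫ ω, residual s s' r T U n k ω ∂P =
      ∑ k ∈ Finset.range n, weight s n k * ∫ ω, T k ω ∂P -
        r * ∑ k ∈ Finset.range n, weight s' n k * ∫ ω, U k ω ∂P := by
  rw [Finset.mul_sum, ← Finset.sum_sub_distrib]
  refine Finset.sum_congr rfl fun k _ => ?_
  simp only [residual]
  rw [integral_sub (((km.memLp_T k).integrable one_le_two).const_mul _)
    (((km.memLp_U k).integrable one_le_two).const_mul _), integral_const_mul, integral_const_mul,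
    mul_assoc]

/-- Weights are kept as products of pairs so that each of the three sums over k fits
`StepSize.tendsto_sum_weight_mul_weight`. -/
theorem variance_residual [IsProbabilityMeasure P]
    (km : KernelMoments P h T U A F A₂ F₂ vTT vTU vUU C)
    (n k : ℕ) :
    Var[residual s s' r T U n k; P] =
      weight s n k * weight s n k * ((∫ ω, T k ω ^ 2 ∂P) - (∫ ω, T k ω ∂P) ^ 2) -
      2 * r * (weight s n k * weight s' n k *
        ((∫ ω, T k ω * U k ω ∂P) - (∫ ω, T k ω ∂P) * ∫ ω, U k ω ∂P)) +
      r ^ 2 * (weight s' n k * weight s' n k *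
        ((∫ ω, U k ω ^ 2 ∂P) - (∫ ω, U k ω ∂P) ^ 2)) := by
  have iT := (km.memLp_T k).integrable one_le_two
  have iU := (km.memLp_U k).integrable one_le_two
  have iTT := (km.memLp_T k).integrable_sq
  have iUU := (km.memLp_U k).integrable_sq
  have iTU : Integrable (fun ω => T k ω * U k ω) P := (km.memLp_T k).integrable_mul (km.memLp_U k)
  rw [variance_eq_sub (km.memLp_residual n k)]
  set c := weight s n k
  set d := r * weight s' n k with hd
  have e1 : ∫ ω, residual s s' r T U n k ω ∂P = c * ∫ ω, T k ω ∂P - d * ∫ ω, U k ω ∂P := by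
    simp only [residual]
    rw [integral_sub (iT.const_mul _) (iU.const_mul _), integral_const_mul, integral_const_mul]
  have e2 : ∫ ω, (residual s s' r T U n k ^ 2) ω ∂P =
      c ^ 2 * ∫ ω, T k ω ^ 2 ∂P - 2 * c * d * ∫ ω, T k ω * U k ω ∂P + d ^ 2 * ∫ ω, U k ω ^ 2 ∂P := by
    have e3 : ∀ ω, (residual s s' r T U n k ^ 2) ω =
        c ^ 2 * T k ω ^ 2 - 2 * c * d * (T k ω * U k ω) + d ^ 2 * U k ω ^ 2 := fun ω => by
      simp only [Pi.pow_apply, residual]; ring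
    simp_rw [e3]
    have i1 : Integrable (fun ω => c ^ 2 * T k ω ^ 2 - 2 * c * d * (T k ω * U k ω)) P :=
      (iTT.const_mul _).sub (iTU.const_mul _)
    rw [integral_add i1 (iUU.const_mul _), integral_sub (iTT.const_mul _) (iTU.const_mul _),
      integral_const_mul, integral_const_mul, integral_const_mul]
  rw [e1, e2, hd]
  ring

theorem tendsto_mean_T (km : KernelMoments P h T U A F A₂ F₂ vTT vTU vUU C)
    (hh : Tendsto h atTop (𝓝 0)) (hpos : ∀ n, 1 ≤ n → 0 < h n) :
    Tendsto (fun k => ∫ ω, T k ω ∂P) atTop (𝓝 A) := by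
  have h1 := (km.mean_T.mul (((tendsto_add_atTop_iff_nat 1).2 hh).pow 2)).add_const A
  rw [zero_pow two_ne_zero, mul_zero, zero_add] at h1
  refine h1.congr fun k => ?_
  have := (hpos (k + 1) (by omega)).ne'
  field_simp
  ring

theorem tendsto_mean_U (km : KernelMoments P h T U A F A₂ F₂ vTT vTU vUU C)
    (hh : Tendsto h atTop (𝓝 0)) (hpos : ∀ n, 1 ≤ n → 0 < h n) :
    Tendsto (fun k => ∫ ω, U k ω ∂P) atTop (𝓝 F) := by
  have h1 := (km.mean_U.mul (((tendsto_add_atTop_iff_nat 1).2 hh).pow 2)).add_const F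
  rw [zero_pow two_ne_zero, mul_zero, zero_add] at h1
  refine h1.congr fun k => ?_
  have := (hpos (k + 1) (by omega)).ne'
  field_simp
  ring

/-- The squared mean stays bounded, so the factor h removes it; the same holds for the covariance
and for U. -/
theorem tendsto_var_T (km : KernelMoments P h T U A F A₂ F₂ vTT vTU vUU C)
    (hh : Tendsto h atTop (𝓝 0)) (hpos : ∀ n, 1 ≤ n → 0 < h n) :
    Tendsto (fun k => h (k + 1) * ((∫ ω, T k ω ^ 2 ∂P) - (∫ ω, T k ω ∂P) ^ 2)) atTop (𝓝 vTT) := by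
  have h1 := km.second_TT.sub (((tendsto_add_atTop_iff_nat 1).2 hh).mul
    ((km.tendsto_mean_T hh hpos).pow 2))
  rw [zero_mul, sub_zero] at h1
  exact h1.congr fun k => by ring

theorem tendsto_cov (km : KernelMoments P h T U A F A₂ F₂ vTT vTU vUU C)
    (hh : Tendsto h atTop (𝓝 0)) (hpos : ∀ n, 1 ≤ n → 0 < h n) :
    Tendsto (fun k => h (k + 1) *
      ((∫ ω, T k ω * U k ω ∂P) - (∫ ω, T k ω ∂P) * ∫ ω, U k ω ∂P)) atTop (𝓝 vTU) := by
  have h1 := km.second_TU.sub (((tendsto_add_atTop_iff_nat 1).2 hh).mul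
    ((km.tendsto_mean_T hh hpos).mul (km.tendsto_mean_U hh hpos)))
  rw [zero_mul, sub_zero] at h1
  exact h1.congr fun k => by ring

theorem tendsto_var_U (km : KernelMoments P h T U A F A₂ F₂ vTT vTU vUU C)
    (hh : Tendsto h atTop (𝓝 0)) (hpos : ∀ n, 1 ≤ n → 0 < h n) :
    Tendsto (fun k => h (k + 1) * ((∫ ω, U k ω ^ 2 ∂P) - (∫ ω, U k ω ∂P) ^ 2)) atTop (𝓝 vUU) := by
  have h1 := km.second_UU.sub (((tendsto_add_atTop_iff_nat 1).2 hh).mul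
    ((km.tendsto_mean_U hh hpos).pow 2))
  rw [zero_mul, sub_zero] at h1
  exact h1.congr fun k => by ring

/-- The denominator estimator is consistent. -/
theorem tendstoInMeasure_denominator [IsProbabilityMeasure P]
    (km : KernelMoments P h T U A F A₂ F₂ vTT vTU vUU C)
    (hh : LogGS (-a) h) (ha : 0 < a) (ha1 : a < 1) :
    TendstoInMeasure P (fun n ω => ∑ k ∈ Finset.range n, weight (fun k : ℕ => (k : ℝ)⁻¹) n k * U k ω)
      atTop (fun _ => F) := by
  have hh0 := hh.tendsto_zero_of_neg (by linarith)
  set γ : ℕ → ℝ := fun k => (k : ℝ)⁻¹ with hγ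
  have hs : StepSize 1 γ := stepSize_inv_natCast
  have hL : ∀ n k, MemLp (fun ω => weight γ n k * U k ω) 2 P := fun n k =>
    (km.memLp_U k).const_mul _
  have hind : ∀ n, iIndepFun (fun k ω => weight γ n k * U k ω) P := fun n =>
    km.indep.comp (fun k p => weight γ n k * p.2) fun k => by fun_prop
  refine tendstoInMeasure_of_integral_sq (fun n => ?_) ?_
  · exact ((memLp_finsetSum _ fun k _ => hL n k).sub (memLp_const F)).integrable_sq
  simp_rw [fun n => integral_sum_sub_sq (hind n) (hL n) F n, variance_const_mul,
    integral_const_mul]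
  have hmean : Tendsto (fun n => ∑ k ∈ Finset.range n, weight γ n k * (∫ ω, U k ω ∂P) - F) atTop
      (𝓝 0) := by
    have := hs.tendsto_sum_weight_sub LogGS.one (q := fun k => ∫ ω, U k ω ∂P) (A := F) (w := 0)
      (by simpa using (km.tendsto_mean_U hh0 hh.pos).sub_const F) (by norm_num)
    simpa using this
  have hvar : Tendsto (fun n => ∑ k ∈ Finset.range n, weight γ n k ^ 2 * Var[U k; P]) atTop
      (𝓝 0) := by
    -- Here the inputs are of order 1/(n h_n), of exponent a - 1 < 0. The reference scale is the
    -- constant 1, with κ = 0.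
    have hq : Tendsto (fun n => γ (n + 1) * ((∫ ω, U n ω ^ 2 ∂P) - (∫ ω, U n ω ∂P) ^ 2) / 1) atTop
        (𝓝 0) := by
      have h1 := ((tendsto_add_atTop_iff_nat 1).2
        ((logGS_inv_natCast.mul hh.inv).tendsto_zero_of_neg (by linarith))).mul
        (km.tendsto_var_U hh0 hh.pos)
      rw [zero_mul] at h1
      refine h1.congr fun n => ?_
      have := (hh.pos (n + 1) (by omega)).ne'
      simp only [hγ]
      field_simp
    have := hs.tendsto_sum_weight_mul_weight hs.tendsto_zero LogGS.one (ρ := 1)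
      (q := fun n => (∫ ω, U n ω ^ 2 ∂P) - (∫ ω, U n ω ∂P) ^ 2)
      (tendsto_const_nhds.congr' (by
        filter_upwards [eventually_ge_atTop 1] with n hn
        rw [div_self (hs.pos n hn).ne'])) hq (by norm_num)
    rw [zero_div] at this
    refine this.congr fun n => ?_
    rw [div_one]
    refine Finset.sum_congr rfl fun k _ => ?_
    rw [variance_eq_sub (km.memLp_U k), sq (weight γ n k)]
    rfl
  simpa using hvar.add (hmean.pow 2)

/-- Bias of `a_n(x) - r f_n(x)`. -/
theorem tendsto_mean_residual [IsProbabilityMeasure P]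
    (km : KernelMoments P h T U A F A₂ F₂ vTT vTU vUU C)
    (hs : StepSize ξ s) (hpos : ∀ n, 1 ≤ n → 0 < h n) (hA : A = r * F)
    (hu : LogGS κ u) (hw : Tendsto (fun n => h n ^ 2 / u n) atTop (𝓝 w))
    (h1 : 0 < 1 + κ * ξ) (h2 : 0 < 1 + κ) :
    Tendsto (fun n => (∑ k ∈ Finset.range n,
      ∫ ω, residual s (fun k : ℕ => (k : ℝ)⁻¹) r T U n k ω ∂P) / u n) atTop
      (𝓝 (A₂ * w / (1 + κ * ξ) - r * (F₂ * w / (1 + κ)))) := by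
  have hw' := (tendsto_add_atTop_iff_nat 1).2 hw
  have hT := hs.tendsto_sum_weight_sub hu (q := fun k => ∫ ω, T k ω ∂P) (A := A) (w := A₂ * w)
    ((km.mean_T.mul hw').congr fun k => by
      have := (hpos (k + 1) (by omega)).ne'
      field_simp) h1
  have hU := stepSize_inv_natCast.tendsto_sum_weight_sub hu (q := fun k => ∫ ω, U k ω ∂P) (A := F)
    (w := F₂ * w) ((km.mean_U.mul hw').congr fun k => by
      have := (hpos (k + 1) (by omega)).ne'
      field_simp) (by rwa [mul_one])
  rw [mul_one] at hU
  refine (hT.sub (hU.const_mul r)).congr fun n => ?_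
  rw [km.sum_integral_residual, hA]
  ring

/-- Variance of `a_n(x) - r f_n(x)`. -/
theorem tendsto_variance_residual [IsProbabilityMeasure P]
    (km : KernelMoments P h T U A F A₂ F₂ vTT vTU vUU C)
    (hs : StepSize ξ s) (hh : Tendsto h atTop (𝓝 0))
    (hpos : ∀ n, 1 ≤ n → 0 < h n) (hu : LogGS κ u)
    (hw : Tendsto (fun n => s n * (h n)⁻¹ / u n) atTop (𝓝 w))
    (h1 : 0 < 2 + κ * ξ) (h2 : 0 < 1 + ξ + κ * ξ) (h3 : 0 < 2 + κ) :
    Tendsto (fun n => (∑ k ∈ Finset.range n,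
      Var[residual s (fun k : ℕ => (k : ℝ)⁻¹) r T U n k; P]) / u n) atTop
      (𝓝 (w * vTT / (2 + κ * ξ) - 2 * r * (ξ * w * vTU / (1 + ξ + κ * ξ)) +
        r ^ 2 * (ξ * w * vUU / (2 + κ)))) := by
  have hs' := stepSize_inv_natCast
  have hw' := (tendsto_add_atTop_iff_nat 1).2 hw
  have hρ : Tendsto (fun n : ℕ => (n : ℝ)⁻¹ / s n) atTop (𝓝 ξ) :=
    hs.tendsto_inv.congr fun n => by rw [mul_inv, div_eq_mul_inv]
  have hρ' := (tendsto_add_atTop_iff_nat 1).2 hρ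
  have self : ∀ {σ : ℕ → ℝ} {ζ : ℝ}, StepSize ζ σ → Tendsto (fun n => σ n / σ n) atTop (𝓝 1) :=
    fun hσ => tendsto_const_nhds.congr' (by
      filter_upwards [eventually_ge_atTop 1] with n hn
      rw [div_self (hσ.pos n hn).ne'])
  have hTT := hs.tendsto_sum_weight_mul_weight hs.tendsto_zero hu (self hs)
    (q := fun k => (∫ ω, T k ω ^ 2 ∂P) - (∫ ω, T k ω ∂P) ^ 2) (w := w * vTT)
    ((hw'.mul (km.tendsto_var_T hh hpos)).congr fun n => by
      have := (hpos (n + 1) (by omega)).ne'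
      field_simp) (by linarith)
  have hTU := hs.tendsto_sum_weight_mul_weight hs'.tendsto_zero hu hρ
    (q := fun k => (∫ ω, T k ω * U k ω ∂P) - (∫ ω, T k ω ∂P) * ∫ ω, U k ω ∂P) (w := ξ * w * vTU)
    (((hρ'.mul hw').mul (km.tendsto_cov hh hpos)).congr fun n => by
      have := (hpos (n + 1) (by omega)).ne'
      have := (hs.pos (n + 1) (by omega)).ne'
      field_simp) h2
  -- This recursion runs at stepsize 1/n, so its own ξ is 1; the factor ξ in the input comes from
  -- rewriting n⁻¹ as (n⁻¹/s_n) s_n.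
  have hUU := hs'.tendsto_sum_weight_mul_weight hs'.tendsto_zero hu (self hs')
    (q := fun k => (∫ ω, U k ω ^ 2 ∂P) - (∫ ω, U k ω ∂P) ^ 2) (w := ξ * w * vUU)
    (((hρ'.mul hw').mul (km.tendsto_var_U hh hpos)).congr fun n => by
      have := (hpos (n + 1) (by omega)).ne'
      have := (hs.pos (n + 1) (by omega)).ne'
      field_simp) (by linarith)
  have e1 : (1 : ℝ) + 1 + κ * ξ = 2 + κ * ξ := by ring
  have e2 : (1 : ℝ) + 1 + κ * 1 = 2 + κ := by ring
  rw [e1] at hTT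
  rw [e2] at hUU
  refine ((hTT.sub (hTU.const_mul (2 * r))).add (hUU.const_mul (r ^ 2))).congr fun n => ?_
  simp_rw [km.variance_residual]
  rw [Finset.sum_add_distrib, Finset.sum_sub_distrib, ← Finset.mul_sum, ← Finset.mul_sum]
  ring

theorem integrable_residual_cube (km : KernelMoments P h T U A F A₂ F₂ vTT vTU vUU C)
    (n k : ℕ) :
    Integrable (fun ω => |residual s s' r T U n k ω| ^ 3) P ∧
    ∫ ω, |residual s s' r T U n k ω| ^ 3 ∂P ≤
      4 * (|weight s n k| ^ 3 * ∫ ω, |T k ω| ^ 3 ∂P +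
        |r| ^ 3 * (|weight s' n k| ^ 3 * ∫ ω, |U k ω| ^ 3 ∂P)) := by
  have hle : ∀ ω, |residual s s' r T U n k ω| ^ 3 ≤
      4 * (|weight s n k| ^ 3 * |T k ω| ^ 3 + |r| ^ 3 * (|weight s' n k| ^ 3 * |U k ω| ^ 3)) := by
    intro ω
    have := abs_add_pow_three_le (weight s n k * T k ω) (-(r * weight s' n k * U k ω))
    rw [abs_neg, ← sub_eq_add_neg, abs_mul, abs_mul, abs_mul, mul_pow, mul_pow, mul_pow,
      mul_assoc (|r| ^ 3)] at this
    exact this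
  have i1 := (km.integrable_T k).const_mul (|weight s n k| ^ 3)
  have i2 := ((km.integrable_U k).const_mul (|weight s' n k| ^ 3)).const_mul (|r| ^ 3)
  have hi : Integrable (fun ω => 4 * (|weight s n k| ^ 3 * |T k ω| ^ 3 +
      |r| ^ 3 * (|weight s' n k| ^ 3 * |U k ω| ^ 3))) P := (i1.add i2).const_mul 4
  have hi' : Integrable (fun ω => |residual s s' r T U n k ω| ^ 3) P := by
    refine hi.mono' ?_ (Eventually.of_forall fun ω => ?_)
    · exact ((continuous_abs.measurable.comp (km.measurable_residual n k)).pow_const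
        3).aestronglyMeasurable
    · rw [Real.norm_of_nonneg (by positivity)]; exact hle ω
  refine ⟨hi', (integral_mono hi' hi hle).trans (le_of_eq ?_)⟩
  rw [integral_const_mul, integral_add i1 i2, integral_const_mul, integral_const_mul,
    integral_const_mul]

/-- Lyapunov sums of `a_n(x) - r f_n(x)`. -/
theorem tendsto_third_residual [IsProbabilityMeasure P]
    (km : KernelMoments P h T U A F A₂ F₂ vTT vTU vUU C)
    (hs : StepSize ξ s) (hpos : ∀ n, 1 ≤ n → 0 < h n) (hu : LogGS κ u)
    (hw : Tendsto (fun n => (s n * (h n)⁻¹) ^ 2 / u n) atTop (𝓝 0))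
    (h1 : 0 < 3 + κ * ξ) (h2 : 0 < 3 + κ) :
    Tendsto (fun n => (∑ k ∈ Finset.range n,
      ∫ ω, |residual s (fun k : ℕ => (k : ℝ)⁻¹) r T U n k ω -
        ∫ ω, residual s (fun k : ℕ => (k : ℝ)⁻¹) r T U n k ω ∂P| ^ 3 ∂P) / u n) atTop (𝓝 0) := by
  have hs' := stepSize_inv_natCast
  have hw' := (tendsto_add_atTop_iff_nat 1).2 hw
  have hρ : Tendsto (fun n : ℕ => (n : ℝ)⁻¹ / s n) atTop (𝓝 ξ) :=
    hs.tendsto_inv.congr fun n => by rw [mul_inv, div_eq_mul_inv]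
  have hρ' := (tendsto_add_atTop_iff_nat 1).2 hρ
  have hT := hs.tendsto_sum_abs_weight_cube hu (q := fun k => C * (h (k + 1) ^ 2)⁻¹)
    (by simpa using (hw'.const_mul C).congr fun n => by field_simp) h1
  have hU := hs'.tendsto_sum_abs_weight_cube hu (q := fun k => C * (h (k + 1) ^ 2)⁻¹)
    (by
      have := ((hρ'.pow 2).mul hw').const_mul C
      rw [mul_zero, mul_zero] at this
      refine this.congr fun n => ?_
      have := (hs.pos (n + 1) (by omega)).ne'
      field_simp) (by rwa [mul_one])
  -- 64 = 16 · 4: centering costs 16, separating T from U costs 4.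
  have hsum := (hT.add (hU.const_mul (|r| ^ 3))).const_mul 64
  rw [mul_zero, add_zero, mul_zero] at hsum
  refine squeeze_zero' ?_ ?_ hsum
  · filter_upwards [eventually_ge_atTop 1] with n hn
    exact div_nonneg (Finset.sum_nonneg fun k _ => integral_nonneg fun _ => by positivity)
      (hu.pos n hn).le
  · filter_upwards [eventually_ge_atTop 1] with n hn
    have hun := hu.pos n hn
    rw [← mul_div_assoc (|r| ^ 3), ← add_div, ← mul_div_assoc]
    refine div_le_div_of_nonneg_right ?_ hun.le
    rw [Finset.mul_sum, ← Finset.sum_add_distrib, Finset.mul_sum]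
    refine Finset.sum_le_sum fun k _ => ?_
    obtain ⟨i1, i2⟩ := km.integrable_residual_cube (s := s) (s' := fun k : ℕ => (k : ℝ)⁻¹)
      (r := r) n k
    have hk : 0 < h (k + 1) ^ 2 := pow_pos (hpos (k + 1) (by omega)) 2
    have bT : ∫ ω, |T k ω| ^ 3 ∂P ≤ C * (h (k + 1) ^ 2)⁻¹ := by
      rw [← div_eq_mul_inv, le_div_iff₀ hk, mul_comm]; exact km.third_T k
    have bU : ∫ ω, |U k ω| ^ 3 ∂P ≤ C * (h (k + 1) ^ 2)⁻¹ := by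
      rw [← div_eq_mul_inv, le_div_iff₀ hk, mul_comm]; exact km.third_U k
    have i3 := (abs_centered_cube_le (km.measurable_residual n k).aestronglyMeasurable i1).2
    have b1 := mul_le_mul_of_nonneg_left bT (by positivity : 0 ≤ |weight s n k| ^ 3)
    have b2 := mul_le_mul_of_nonneg_left
      (mul_le_mul_of_nonneg_left bU (by positivity : 0 ≤ |weight (fun k : ℕ => (k : ℝ)⁻¹) n k| ^ 3))
      (by positivity : 0 ≤ |r| ^ 3)
    linarith

/-- Mean square of a multiple of `a_n(x) - r f_n(x)`. -/
theorem integral_residual_sub_sq [IsProbabilityMeasure P]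
    (km : KernelMoments P h T U A F A₂ F₂ vTT vTU vUU C)
    (c d : ℝ) (n : ℕ) :
    ∫ ω, (c * ∑ k ∈ Finset.range n, residual s s' r T U n k ω - d) ^ 2 ∂P =
      c ^ 2 * ∑ k ∈ Finset.range n, Var[residual s s' r T U n k; P] +
        (c * ∑ k ∈ Finset.range n, (∫ ω, residual s s' r T U n k ω ∂P) - d) ^ 2 := by
  have := integral_sum_sub_sq (L := fun k ω => c * residual s s' r T U n k ω)
    ((km.iIndepFun_residual n).comp (fun _ y => c * y) fun _ => by fun_prop)
    (fun k => (km.memLp_residual n k).const_mul c) d n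
  simp_rw [variance_const_mul, integral_const_mul, ← Finset.mul_sum] at this
  exact this

theorem integrable_residual_sub_sq [IsProbabilityMeasure P]
    (km : KernelMoments P h T U A F A₂ F₂ vTT vTU vUU C)
    (c d : ℝ) (n : ℕ) :
    Integrable (fun ω => (c * ∑ k ∈ Finset.range n, residual s s' r T U n k ω - d) ^ 2) P :=
  (((memLp_finsetSum _ fun k _ => km.memLp_residual n k).const_mul c).sub
    (memLp_const d)).integrable_sq

end KernelMoments

/-! ### Consequences of the assumption on stepsize and bandwidth -/

namespace A2

variable {β a ξ : ℝ} {βs h : ℕ → ℝ}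

theorem stepSize (hA : A2 β a βs h)
    (hξ : Tendsto (fun n : ℕ => ((n : ℝ) * βs n)⁻¹) atTop (𝓝 ξ)) : StepSize ξ βs :=
  ⟨hA.step.1, hA.step.logGS.tendsto_zero_of_neg (by linarith [hA.lt_β]), hξ⟩

theorem limit_nonneg (hA : A2 β a βs h)
    (hξ : Tendsto (fun n : ℕ => ((n : ℝ) * βs n)⁻¹) atTop (𝓝 ξ)) : 0 ≤ ξ := by
  refine ge_of_tendsto hξ ?_
  filter_upwards [eventually_ge_atTop 1] with n hn
  have := hA.step.1 n hn
  positivity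

/-- If β < 1, then (n β_n)⁻¹ has exponent β - 1 < 0 and ξ = 0. -/
theorem one_sub_mul_eq_zero (hA : A2 β a βs h)
    (hξ : Tendsto (fun n : ℕ => ((n : ℝ) * βs n)⁻¹) atTop (𝓝 ξ)) : (1 - β) * ξ = 0 := by
  rcases hA.β_le.eq_or_lt with h1 | h1
  · rw [h1]; ring
  · have h2 := (logGS_inv_natCast.mul hA.step.logGS.inv).tendsto_zero_of_neg (by linarith)
    have h3 : ξ = 0 := tendsto_nhds_unique hξ (h2.congr fun n => by rw [mul_inv])
    rw [h3, mul_zero]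

/-- A finite limit L satisfies L ξ = 1 with ξ > 0, so the strict lower bound on L transfers; an
infinite limit means ξ = 0. -/
theorem min_mul_lt_one (hA : A2 β a βs h)
    (hξ : Tendsto (fun n : ℕ => ((n : ℝ) * βs n)⁻¹) atTop (𝓝 ξ)) :
    min (2 * a) ((β - a) / 2) * ξ < 1 := by
  rcases hA.limit with ⟨L, hL, hlim⟩ | hlim
  · have h1 : L * ξ = 1 := by
      refine tendsto_nhds_unique (hlim.mul hξ) (tendsto_const_nhds.congr' ?_)
      filter_upwards [eventually_ge_atTop 1] with n hn
      have := hA.step.1 n hn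
      rw [mul_inv_cancel₀ (by positivity)]
    have h2 : ξ ≠ 0 := fun h0 => by rw [h0, mul_zero] at h1; exact zero_ne_one h1
    have h3 : 0 < ξ := lt_of_le_of_ne (hA.limit_nonneg hξ) h2.symm
    rw [← h1]
    exact mul_lt_mul_of_pos_right hL h3
  · have : ξ = 0 := tendsto_nhds_unique hξ (tendsto_inv_atTop_zero.comp hlim)
    rw [this, mul_zero]
    exact one_pos

theorem logGS_ratio (hA : A2 β a βs h) : LogGS (-β + a) (fun n => βs n * (h n)⁻¹) := by
  have := hA.step.logGS.mul hA.bandwidth.logGS.inv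
  rwa [neg_neg] at this

theorem logGS_bias (hA : A2 β a βs h) : LogGS (β - 5 * a) (fun n => (βs n)⁻¹ * h n ^ 5) := by
  have := hA.step.logGS.inv.mul (hA.bandwidth.logGS.pow 5)
  have e : -(-β) + ((5 : ℕ) : ℝ) * (-a) = β - 5 * a := by push_cast; ring
  rwa [e] at this

end A2

/-! ### Limit theorems for the ratio of the weighted sums -/

section Limits

variable {Ω : Type*} [MeasurableSpace Ω] {P : Measure Ω} [IsProbabilityMeasure P]
  {β a ξ : ℝ} {βs h : ℕ → ℝ} {T U : ℕ → Ω → ℝ} {A F A₂ F₂ vTT vTU vUU C r : ℝ}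

/-- Asymptotic normality of the ratio of the two weighted sums. -/
theorem KernelMoments.tendstoInDistribution_ratio
    (km : KernelMoments P h T U A F A₂ F₂ vTT vTU vUU C) (hA2 : A2 β a βs h)
    (hξ : Tendsto (fun n : ℕ => ((n : ℝ) * βs n)⁻¹) atTop (𝓝 ξ))
    (hF : 0 < F) (hA : A = r * F) {c : ℝ}
    (hc : Tendsto (fun n : ℕ => (βs n)⁻¹ * h n ^ 5) atTop (𝓝 c))
    (hinf : Tendsto (fun n : ℕ => (βs n)⁻¹ * h n) atTop atTop)
    {ρ : ℕ → Ω → ℝ} (hρm : ∀ n, AEMeasurable (ρ n) P)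
    (hρ : ∀ n ω, ∑ k ∈ Finset.range n, weight (fun k : ℕ => (k : ℝ)⁻¹) n k * U k ω ≠ 0 →
      ρ n ω = (∑ k ∈ Finset.range n, weight βs n k * T k ω) /
        ∑ k ∈ Finset.range n, weight (fun k : ℕ => (k : ℝ)⁻¹) n k * U k ω)
    {V : ℝ} (hV : F⁻¹ ^ 2 * (vTT / (2 - (β - a) * ξ) - 2 * r * (ξ * vTU / (1 + a * ξ)) +
        r ^ 2 * (ξ * vUU / (1 + a))) = V)
    {B : ℝ} (hB : F⁻¹ * (A₂ / (1 - 2 * a * ξ) - r * (F₂ / (1 - 2 * a))) = B) :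
    0 ≤ V ∧ TendstoInDistribution (fun n ω => √((βs n)⁻¹ * h n) * (ρ n ω - r)) atTop (id : ℝ → ℝ)
      (fun _ => P) (gaussianReal (√c * B) V.toNNReal) := by
  have hs := hA2.stepSize hξ
  have hξ0 := hA2.limit_nonneg hξ
  have hβξ := hA2.one_sub_mul_eq_zero hξ
  have hh := hA2.bandwidth.logGS
  have ha := hA2.a_pos
  have ha1 := hA2.a_lt
  have hβ1 := hA2.β_le
  have hβ0 := hA2.lt_β
  have hh0 := hh.tendsto_zero_of_neg (by linarith)
  -- A finite limit excludes a positive exponent, so (β - a)/2 is the smaller term of the minimum.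
  -- The resulting (β - a) ξ < 2 is exactly the positivity of m + κξ for the numerator's bias (m =
  -- 1), variance (m = 2) and Lyapunov sum (m = 3), with κ = m (a - β)/2.
  have hβ5 : β - 5 * a ≤ 0 := hA2.logGS_bias.nonpos_of_tendsto hc
  have hmin : (β - a) * ξ < 2 := by
    have := hA2.min_mul_lt_one hξ
    rw [min_eq_right (by linarith)] at this
    linarith
  set ratio : ℕ → ℝ := fun n => βs n * (h n)⁻¹ with hratio
  have hG : LogGS (-β + a) ratio := hA2.logGS_ratio
  have hG1 := hG.sqrt
  have hG3 := hG1.pow 3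
  have hσ : ∀ n, √((βs n)⁻¹ * h n) = (√(ratio n))⁻¹ := fun n => by
    rw [← Real.sqrt_inv, hratio, mul_inv, inv_inv]
  have hratio0 : Tendsto ratio atTop (𝓝 0) := by
    refine (tendsto_inv_atTop_zero.comp hinf).congr fun n => ?_
    simp only [Function.comp_apply, hratio, mul_inv, inv_inv]
  set γ : ℕ → ℝ := fun k => (k : ℝ)⁻¹ with hγ
  set E : ℕ → ℕ → Ω → ℝ := residual βs γ r T U with hE
  have hbias : Tendsto (fun n => h n ^ 2 / √(ratio n)) atTop (𝓝 √c) := by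
    refine ((Real.continuous_sqrt.tendsto c).comp hc).congr' ?_
    filter_upwards [eventually_ge_atTop 1] with n hn
    have e : (βs n)⁻¹ * h n ^ 5 = (h n ^ 2) ^ 2 * ((βs n)⁻¹ * h n) := by ring
    rw [Function.comp_apply, e, Real.sqrt_mul (by positivity), Real.sqrt_sq (by positivity), hσ,
      div_eq_mul_inv]
  have hmean := km.tendsto_mean_residual (r := r) hs hh.pos hA hG1 hbias (by linarith) (by linarith)
  have hvar := km.tendsto_variance_residual (r := r) hs hh0 hh.pos hG (w := 1)
    (tendsto_const_nhds.congr' (by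
      filter_upwards [eventually_ge_atTop 1] with n hn
      rw [div_self (hG.pos n hn).ne']))
    (by linarith) (by nlinarith) (by linarith)
  have hthird := km.tendsto_third_residual (r := r) hs hh.pos hG3
    (by
      have h1 := (Real.continuous_sqrt.tendsto 0).comp hratio0
      rw [Real.sqrt_zero] at h1
      refine h1.congr' ?_
      filter_upwards [eventually_ge_atTop 1] with n hn
      have h2 := hG1.pos n hn
      have h3 : √(ratio n) ^ 2 = ratio n := Real.sq_sqrt (hG.pos n hn).le
      change √(ratio n) = ratio n ^ 2 / √(ratio n) ^ 3
      rw [eq_div_iff (by positivity)]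
      nth_rewrite 3 [← h3]
      ring) (by push_cast; linarith) (by push_cast; linarith)
  rw [← hE] at hmean hvar hthird
  have hVlim : Tendsto (fun n => F⁻¹ ^ 2 * ((∑ k ∈ Finset.range n, Var[E n k; P]) / ratio n)) atTop
      (𝓝 V) := by
    have e1 : 2 + (-β + a) * ξ = 2 - (β - a) * ξ := by ring
    have e2 : 1 + ξ + (-β + a) * ξ = 1 + a * ξ := by linear_combination hβξ
    -- Either β = 1 and the denominators agree, or ξ = 0 and both sides vanish.
    have e3 : ξ * 1 * vUU / (2 + (-β + a)) = ξ * vUU / (1 + a) := by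
      rcases mul_eq_zero.1 hβξ with h0 | h0
      · rw [mul_one]; congr 1; linarith
      · simp [h0]
    have := hvar.const_mul (F⁻¹ ^ 2)
    rwa [e1, e2, e3, one_mul, mul_one, hV] at this
  have hBlim : Tendsto (fun n => F⁻¹ *
      ((∑ k ∈ Finset.range n, ∫ ω, E n k ω ∂P) / √(ratio n))) atTop (𝓝 (√c * B)) := by
    have := hmean.const_mul F⁻¹
    -- For c = 0 both sides vanish whatever B is, even if 1 - 2aξ = 0. For c ≠ 0 the exponent β - 5a
    -- must be 0, which turns (a - β)/2 into -2a.
    rcases eq_or_ne c 0 with rfl | hc0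
    · simpa using this
    · have hβa : β = 5 * a := by linarith [hA2.logGS_bias.eq_zero_of_tendsto hc hc0]
      have e1 : 1 + (-β + a) / 2 * ξ = 1 - 2 * a * ξ := by rw [hβa]; ring
      have e2 : 1 + (-β + a) / 2 = 1 - 2 * a := by rw [hβa]; ring
      rw [e1, e2] at this
      convert this using 2
      rw [← hB]
      ring
  set d : ℕ → ℝ := fun n => F⁻¹ * (√(ratio n))⁻¹ with hd
  have hd0 : ∀ n, 0 ≤ d n := fun n => by positivity
  have hd2 : ∀ n, 1 ≤ n → d n ^ 2 = F⁻¹ ^ 2 * (ratio n)⁻¹ := fun n hn => by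
    simp only [hd]
    rw [mul_pow, inv_pow (√(ratio n)), Real.sq_sqrt (hG.pos n hn).le]
  have hclt := tendstoInDistribution_of_lyapunov (P := P)
    (Z := fun n k ω => d n * (E n k ω - ∫ ω, E n k ω ∂P))
    (b := fun n => F⁻¹ * ((∑ k ∈ Finset.range n, ∫ ω, E n k ω ∂P) / √(ratio n)))
    (b₀ := √c * B) (V := V) ?_ ?_ ?_ ?_ ?_ ?_ hBlim
  rotate_left
  · exact fun n => (km.iIndepFun_residual n).comp
      (fun k y => d n * (y - ∫ ω, E n k ω ∂P)) fun k => by fun_prop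
  · exact fun n k => (((km.measurable_residual n k).sub_const _).const_mul _).aemeasurable
  · intro n k
    have h1 := (abs_centered_cube_le (km.measurable_residual n k).aestronglyMeasurable
      (km.integrable_residual_cube (s := βs) (s' := γ) (r := r) n k).1).1
    refine (h1.const_mul (d n ^ 3)).congr (Eventually.of_forall fun ω => ?_)
    simp only
    rw [abs_mul, abs_of_nonneg (hd0 n)]
    exact (mul_pow _ _ _).symm
  · intro n k
    rw [integral_const_mul, integral_sub ((km.memLp_residual n k).integrable one_le_two)
      (integrable_const _)]
    simp [hE]
  · refine hVlim.congr' ?_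
    filter_upwards [eventually_ge_atTop 1] with n hn
    simp_rw [mul_pow, integral_const_mul]
    rw [← Finset.mul_sum, hd2 n hn, div_eq_inv_mul, ← mul_assoc]
    congr 1
    refine Finset.sum_congr rfl fun k _ => ?_
    exact variance_eq_integral (km.measurable_residual n k).aemeasurable
  · have := hthird.const_mul (F⁻¹ ^ 3)
    rw [mul_zero] at this
    refine this.congr fun n => ?_
    simp_rw [abs_mul, mul_pow, integral_const_mul, abs_of_nonneg (hd0 n)]
    rw [← Finset.mul_sum]
    simp only [hd]
    rw [mul_pow, inv_pow (√(ratio n)), div_eq_inv_mul, ← mul_assoc]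
  refine ⟨ge_of_tendsto hVlim ?_, ?_⟩
  · filter_upwards [eventually_ge_atTop 1] with n hn
    have h1 : 0 ≤ ∑ k ∈ Finset.range n, Var[E n k; P] :=
      Finset.sum_nonneg fun k _ => variance_nonneg _ _
    have h2 := (hG.pos n hn).le
    positivity
  have hsum : ∀ n ω, F⁻¹ * ((∑ k ∈ Finset.range n, ∫ ω, E n k ω ∂P) / √(ratio n)) +
      ∑ k ∈ Finset.range n, d n * (E n k ω - ∫ ω, E n k ω ∂P) =
      F⁻¹ * ((√(ratio n))⁻¹ * (∑ k ∈ Finset.range n, weight βs n k * T k ω -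
        r * ∑ k ∈ Finset.range n, weight γ n k * U k ω)) := by
    intro n ω
    rw [← sum_residual, ← Finset.mul_sum, Finset.sum_sub_distrib]
    simp only [hd, hE]
    ring
  simp_rw [hsum] at hclt
  simp_rw [hσ]
  have hiW : ∀ n, Integrable (fun ω => ((√(ratio n))⁻¹ *
      (∑ k ∈ Finset.range n, weight βs n k * T k ω -
        r * ∑ k ∈ Finset.range n, weight γ n k * U k ω)) ^ 2) P := fun n => by
    simpa only [sum_residual, sub_zero] using
      km.integrable_residual_sub_sq (s := βs) (s' := γ) (r := r) (√(ratio n))⁻¹ 0 n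
  -- Convergence of the mean squares provides the eventual bound required to replace the random
  -- denominator by F.
  have hW2 : Tendsto (fun n => ∫ ω, ((√(ratio n))⁻¹ *
      (∑ k ∈ Finset.range n, weight βs n k * T k ω -
        r * ∑ k ∈ Finset.range n, weight γ n k * U k ω)) ^ 2 ∂P) atTop
      (𝓝 (F ^ 2 * V + (F * (√c * B)) ^ 2)) := by
    refine ((hVlim.const_mul (F ^ 2)).add ((hBlim.const_mul F).pow 2)).congr' ?_
    filter_upwards [eventually_ge_atTop 1] with n hn
    have h1 := km.integral_residual_sub_sq (s := βs) (s' := γ) (r := r) (√(ratio n))⁻¹ 0 n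
    simp only [sum_residual, sub_zero] at h1
    rw [h1, inv_pow (√(ratio n)), Real.sq_sqrt (hG.pos n hn).le]
    have := hF.ne'
    simp only [hE]
    field_simp
  exact tendstoInDistribution_of_tendstoInMeasure_sub _ _ hclt
    (tendstoInMeasure_mul_ratio_sub hF hiW
      ((hW2.eventually (gt_mem_nhds (lt_add_one _))).mono fun n hn => hn.le)
      (km.tendstoInMeasure_denominator hh ha ha1) hρ)
    fun n => ((hρm n).sub_const _).const_mul _

/-- Convergence in probability of the ratio of the two weighted sums when the bias dominates. -/
theorem KernelMoments.tendstoInMeasure_ratio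
    (km : KernelMoments P h T U A F A₂ F₂ vTT vTU vUU C) (hA2 : A2 β a βs h)
    (hξ : Tendsto (fun n : ℕ => ((n : ℝ) * βs n)⁻¹) atTop (𝓝 ξ))
    (hF : 0 < F) (hA : A = r * F)
    (hinf : Tendsto (fun n : ℕ => (βs n)⁻¹ * h n ^ 5) atTop atTop)
    {ρ : ℕ → Ω → ℝ}
    (hρ : ∀ n ω, ∑ k ∈ Finset.range n, weight (fun k : ℕ => (k : ℝ)⁻¹) n k * U k ω ≠ 0 →
      ρ n ω = (∑ k ∈ Finset.range n, weight βs n k * T k ω) /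
        ∑ k ∈ Finset.range n, weight (fun k : ℕ => (k : ℝ)⁻¹) n k * U k ω)
    {B : ℝ} (hB : F⁻¹ * (A₂ / (1 - 2 * a * ξ) - r * (F₂ / (1 - 2 * a))) = B) :
    TendstoInMeasure P (fun n ω => (h n ^ 2)⁻¹ * (ρ n ω - r)) atTop (fun _ => B) := by
  have hs := hA2.stepSize hξ
  have hξ0 := hA2.limit_nonneg hξ
  have hh := hA2.bandwidth.logGS
  have ha := hA2.a_pos
  have ha1 := hA2.a_lt
  have hβ1 := hA2.β_le
  have hh0 := hh.tendsto_zero_of_neg (by linarith)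
  -- Divergence excludes a negative exponent, so 2a is the smaller term of the minimum, giving 2aξ <
  -- 1. Moreover β ≤ 1 yields a ≤ 1/5, which settles the remaining positivity conditions.
  have hβ5 : 0 ≤ β - 5 * a := hA2.logGS_bias.nonneg_of_tendsto_atTop hinf
  have hmin : 2 * a * ξ < 1 := by
    have := hA2.min_mul_lt_one hξ
    rwa [min_eq_left (by linarith)] at this
  have hmean := km.tendsto_mean_residual (r := r) hs hh.pos hA (hh.pow 2) (w := 1)
    (tendsto_const_nhds.congr' (by
      filter_upwards [eventually_ge_atTop 1] with n hn
      rw [div_self (pow_pos (hh.pos n hn) 2).ne']))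
    (by push_cast; linarith) (by push_cast; linarith)
  -- At the scale h⁴ of the squared bias, β_n h_n⁻¹ / h_n⁴ is the inverse of β_n⁻¹ h_n⁵, so the
  -- limit w is 0.
  have hvar := km.tendsto_variance_residual (r := r) hs hh0 hh.pos (hh.pow 4) (w := 0)
    ((tendsto_inv_atTop_zero.comp hinf).congr' (by
      filter_upwards [eventually_ge_atTop 1] with n hn
      have := (hh.pos n hn).ne'
      have := (hs.pos n hn).ne'
      simp only [Function.comp_apply]
      field_simp))
    (by push_cast; linarith) (by push_cast; nlinarith) (by push_cast; linarith)
  simp only [zero_mul, mul_zero, zero_div, sub_zero, add_zero] at hvar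
  have hBlim : Tendsto (fun n => F⁻¹ * ((∑ k ∈ Finset.range n,
      ∫ ω, residual βs (fun k : ℕ => (k : ℝ)⁻¹) r T U n k ω ∂P) / h n ^ 2)) atTop (𝓝 B) := by
    have := hmean.const_mul F⁻¹
    have e1 : 1 + ((2 : ℕ) : ℝ) * -a * ξ = 1 - 2 * a * ξ := by push_cast; ring
    have e2 : 1 + ((2 : ℕ) : ℝ) * -a = 1 - 2 * a := by push_cast; ring
    rwa [e1, e2, mul_one, mul_one, hB] at this
  -- A free centre d serves twice: d = B gives mean square convergence, d = 0 gives the bound needed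
  -- for the denominator.
  have hmse : ∀ d : ℝ, Tendsto (fun n => ∫ ω, (F⁻¹ * ((h n ^ 2)⁻¹ *
      (∑ k ∈ Finset.range n, weight βs n k * T k ω -
        r * ∑ k ∈ Finset.range n, weight (fun k : ℕ => (k : ℝ)⁻¹) n k * U k ω)) - d) ^ 2 ∂P) atTop
      (𝓝 ((B - d) ^ 2)) := by
    intro d
    have := (hvar.const_mul (F⁻¹ ^ 2)).add ((hBlim.sub_const d).pow 2)
    rw [mul_zero, zero_add] at this
    refine this.congr fun n => ?_
    have h1 := km.integral_residual_sub_sq (s := βs) (s' := fun k : ℕ => (k : ℝ)⁻¹) (r := r)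
      (F⁻¹ * (h n ^ 2)⁻¹) d n
    simp only [sum_residual] at h1
    simp_rw [← mul_assoc] at h1 ⊢
    rw [h1]
    ring
  have hi : ∀ (c d : ℝ) n, Integrable (fun ω => (c * ((h n ^ 2)⁻¹ *
      (∑ k ∈ Finset.range n, weight βs n k * T k ω -
        r * ∑ k ∈ Finset.range n, weight (fun k : ℕ => (k : ℝ)⁻¹) n k * U k ω)) - d) ^ 2) P := by
    intro c d n
    simpa only [sum_residual, ← mul_assoc] using km.integrable_residual_sub_sq (s := βs)
      (s' := fun k : ℕ => (k : ℝ)⁻¹) (r := r) (c * (h n ^ 2)⁻¹) d n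
  have hlim : TendstoInMeasure P (fun n ω => F⁻¹ * ((h n ^ 2)⁻¹ *
      (∑ k ∈ Finset.range n, weight βs n k * T k ω -
        r * ∑ k ∈ Finset.range n, weight (fun k : ℕ => (k : ℝ)⁻¹) n k * U k ω))) atTop
      (fun _ => B) :=
    tendstoInMeasure_of_integral_sq (fun n => hi F⁻¹ B n) (by simpa using hmse B)
  have hsq : Tendsto (fun n => ∫ ω, ((h n ^ 2)⁻¹ *
      (∑ k ∈ Finset.range n, weight βs n k * T k ω -
        r * ∑ k ∈ Finset.range n, weight (fun k : ℕ => (k : ℝ)⁻¹) n k * U k ω)) ^ 2 ∂P) atTop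
      (𝓝 (F ^ 2 * B ^ 2)) := by
    have := (hmse 0).const_mul (F ^ 2)
    simp only [sub_zero] at this
    refine this.congr fun n => ?_
    rw [← integral_const_mul]
    congr 1; ext ω
    rw [← mul_pow, mul_inv_cancel_left₀ hF.ne']
  exact tendstoInMeasure_of_sub (tendstoInMeasure_mul_ratio_sub hF
    (fun n => by simpa using hi 1 0 n)
    ((hsq.eventually (gt_mem_nhds (lt_add_one _))).mono fun n hn => hn.le)
    (km.tendstoInMeasure_denominator hh ha ha1) hρ) hlim

end Limits

end SemiRec

end

/-! ### The main theorem -/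

theorem theorem1 {Ω : Type*} [MeasurableSpace Ω] (P : Measure Ω) [IsProbabilityMeasure P]
    (X Y : ℕ → Ω → ℝ) (g : ℝ → ℝ → ℝ) (hXY : SemiRec.IsSample P X Y g)
    (K : ℝ → ℝ) (β a ξ : ℝ) (βs h : ℕ → ℝ) (x : ℝ)
    (hA1 : SemiRec.A1 K) (hA2 : SemiRec.A2 β a βs h) (hA3 : SemiRec.A3 g x)
    (hfx : 0 < SemiRec.dens g x)
    (hf2 : SemiRec.TwiceDifferentiableAt (SemiRec.dens g) x)
    (ha2 : SemiRec.TwiceDifferentiableAt (SemiRec.afun g) x)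
    (hξ : Tendsto (fun n : ℕ => ((n : ℝ) * βs n)⁻¹) atTop (𝓝 ξ)) :
    (∀ c : ℝ, 0 ≤ c → Tendsto (fun n : ℕ => (βs n)⁻¹ * h n ^ 5) atTop (𝓝 c) →
      Tendsto (fun n : ℕ => (βs n)⁻¹ * h n) atTop atTop →
      0 ≤ SemiRec.varConst K g a ξ β x ∧
      TendstoInDistribution
        (fun (n : ℕ) (ω : Ω) => √((βs n)⁻¹ * h n) *
          (SemiRec.rEst K h x βs (fun k : ℕ => (k : ℝ)⁻¹) X Y n ω - SemiRec.regr g x))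
        atTop (id : ℝ → ℝ) (fun _ : ℕ => P)
        (gaussianReal (√c * SemiRec.biasConst K g a ξ x)
          (SemiRec.varConst K g a ξ β x).toNNReal)) ∧
    (Tendsto (fun n : ℕ => (βs n)⁻¹ * h n ^ 5) atTop atTop →
      TendstoInMeasure P
        (fun (n : ℕ) (ω : Ω) => (h n ^ 2)⁻¹ *
          (SemiRec.rEst K h x βs (fun k : ℕ => (k : ℝ)⁻¹) X Y n ω - SemiRec.regr g x))
        atTop (fun _ : Ω => SemiRec.biasConst K g a ξ x)) := by
  have hh0 := hA2.bandwidth.logGS.tendsto_zero_of_neg (by linarith [hA2.a_pos])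
  obtain ⟨C, km⟩ := hXY.kernelMoments hA1 hA3 hA2.bandwidth.1 hh0 hf2 ha2
  have hA : SemiRec.afun g x = SemiRec.regr g x * SemiRec.dens g x := by
    rw [SemiRec.regr, div_mul_cancel₀ _ hfx.ne']
  -- The value 0 assigned where f_n vanishes is irrelevant: f_n converges in probability to f(x) >
  -- 0.
  have hρ : ∀ n ω, ∑ k ∈ Finset.range n, SemiRec.weight (fun k : ℕ => (k : ℝ)⁻¹) n k *
      SemiRec.denTerm K h x X k ω ≠ 0 →
      SemiRec.rEst K h x βs (fun k : ℕ => (k : ℝ)⁻¹) X Y n ω =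
        (∑ k ∈ Finset.range n, SemiRec.weight βs n k * SemiRec.numTerm K h x X Y k ω) /
        ∑ k ∈ Finset.range n, SemiRec.weight (fun k : ℕ => (k : ℝ)⁻¹) n k *
          SemiRec.denTerm K h x X k ω := by
    intro n ω hne
    rw [← SemiRec.fEst_eq_sum] at hne ⊢
    rw [SemiRec.rEst, if_pos hne, SemiRec.aEst_eq_sum]
  have hB : (SemiRec.dens g x)⁻¹ *
      (iteratedDeriv 2 (SemiRec.afun g) x / 2 * SemiRec.kernelMoment 2 K / (1 - 2 * a * ξ) -
        SemiRec.regr g x * (iteratedDeriv 2 (SemiRec.dens g) x / 2 * SemiRec.kernelMoment 2 K /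
          (1 - 2 * a))) = SemiRec.biasConst K g a ξ x := by
    rw [SemiRec.biasConst]
    ring
  refine ⟨fun c _ hc hinf => ?_, fun hinf =>
    km.tendstoInMeasure_ratio hA2 hξ hfx hA hinf hρ hB⟩
  refine km.tendstoInDistribution_ratio hA2 hξ hfx hA hc hinf (fun n => ?_) hρ ?_ hB
  · have hN : Measurable (fun ω => SemiRec.aEst K h x βs X Y n ω) := by
      simp_rw [SemiRec.aEst_eq_sum]
      exact Finset.measurable_fun_sum _ fun k _ => (km.meas_T k).const_mul _
    have hD : Measurable (fun ω => SemiRec.fEst K h x (fun k : ℕ => (k : ℝ)⁻¹) X n ω) := by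
      simp_rw [SemiRec.fEst_eq_sum]
      exact Finset.measurable_fun_sum _ fun k _ => (km.meas_U k).const_mul _
    exact (Measurable.ite (hD (measurableSet_singleton 0).compl) (hN.div hD)
      measurable_const).aemeasurable
  -- Writing a(x) = r f(x) in the covariance limit merges it with the variance of f_n into a single
  -- multiple of r²/f.
  · rw [SemiRec.varConst, SemiRec.condSecondMoment, hA]
    have hf := hfx.ne'
    field_simp
    ring
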